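/- Let $k$ be a field, let $K/k$ be a separable field extension of degree $6$ with Galois closure $\widetilde K/k$, and assume that $G=\mathrm{Gal}(\widetilde K/k)$ is isomorphic to $F_{36}{:}2$, the transitive permutation group of degree $6$ and order $72$ (number 6T13) consisting of all permutations of six points that preserve a partition into two blocks of size three; it is the wreath product $S_3\wr S_2$. View $G$ as a group of permutations of the six cosets in $G/\mathrm{Gal}(\widetilde K/K)$, that is, as a subgroup of $S_6$. A finite extension $E/k$ is called Hopf Galois if there is a finite-dimensional cocommutative $k$-Hopf algebra $H$ such that $E$ is an $H$-module algebra and the $k$-linear map $j:E\otimes_k H\to \mathrm{End}_k(E)$, $j(s\otimes h)(t)=s\,h(t)$, is bijective. For a field $F$ with $K\subseteq F\subseteq\widetilde K$, put $G''=\mathrm{Gal}(\widetilde K/F)$ and let $\lambda:G\to\mathrm{Sym}(G/G'')$ be the action by left translation; $F/k$ is called almost classically Galois if there is a regular subgroup $N$ of $\mathrm{Sym}(G/G'')$ that is normalized by $\lambda(G)$ and contained in $\lambda(G)$. Let $F$ be a field with $K\subseteq F\subseteq \widetilde K$. (1) If $[F:k]=12$, then $F/k$ is not Hopf Galois. (2)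 If $[F:k]=18$, then $F/k$ is Hopf Galois but not almost classically Galois. (3) If $[F:k]=24$, then $F/k$ is not Hopf Galois. (4) If $\mathrm{Gal}(\widetilde K/F)$ is generated by an element that is a transposition in $S_6$, then $[F:k]=36$ and $F/k$ is almost classically Galois. Such fields $F$ exist; in particular there are intermediate fields $F$ with $[F:k]=36$ and $F/k$ almost classically Galois. -/

import Mathlib

open scoped TensorProduct

universe u v

section HopfGalois

variable {k : Type u} {H : Type u} {E : Type v} [Field k] [Field E] [Algebra k E]
  [Ring H] [HopfAlgebra k H]

/-- An action `μ : H → End_k(E)` of a Hopf algebra `H` makes `E` an `H`-module algebra: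
`h(1) = ε(h)1`, and `h(xy) = ∑ h₍₁₎(x) h₍₂₎(y)` where `Δ(h) = ∑ h₍₁₎ ⊗ h₍₂₎`. -/
def IsModuleAlgebraAction (μ : H →ₐ[k] Module.End k E) : Prop :=
  (∀ h : H, μ h 1 = algebraMap k E (Coalgebra.counit (R := k) h)) ∧
  ∀ (h : H) (x y : E),
    μ h (x * y) = LinearMap.mul' k E
      (TensorProduct.map (μ.toLinearMap.flip x) (μ.toLinearMap.flip y)
        (Coalgebra.comul (R := k) h))

/-- The `k`-linear map `j : E ⊗ H → End_k(E)`, `j(s ⊗ h)(t) = s h(t)`. -/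
noncomputable def hopfGaloisMap (μ : H →ₐ[k] Module.End k E) :
    E ⊗[k] H →ₗ[k] Module.End k E :=
  LinearMap.mul' k (Module.End k E) ∘ₗ
    TensorProduct.map (Algebra.lmul k E).toLinearMap μ.toLinearMap

theorem hopfGaloisMap_tmul (μ : H →ₐ[k] Module.End k E) (s t : E) (h : H) :
    hopfGaloisMap μ (s ⊗ₜ[k] h) t = s * μ h t := by
  simp [hopfGaloisMap]

end HopfGalois

/-- `E/k` is a Hopf Galois extension: there is a finite cocommutative `k`-Hopf algebra `H` such
that `E` is an `H`-module algebra and `j : E ⊗ H → End_k(E)` is bijective.  As `H` is a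
finite-dimensional `k`-vector space, it loses nothing to take `H` in the universe of `k`. -/
def IsHopfGalois (k : Type u) (E : Type v) [Field k] [Field E] [Algebra k E] : Prop :=
  ∃ (H : Type u) (_ : Ring H) (_ : HopfAlgebra k H),
    Module.Finite k H ∧ Coalgebra.IsCocomm k H ∧
    ∃ μ : H →ₐ[k] Module.End k E,
      IsModuleAlgebraAction μ ∧ Function.Bijective (hopfGaloisMap μ)

/-- `N` is a regular group of permutations of `X`: it acts simply transitively on `X`. -/
def IsRegularPermGroup {X : Type*} (N : Subgroup (Equiv.Perm X)) : Prop :=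
  ∀ x y : X, ∃! σ : Equiv.Perm X, σ ∈ N ∧ σ x = y

/-- The left translation action `λ : G → Sym(G/G')` on left cosets, where `G = Gal(L/k)` and
`G' = Gal(L/F)`. -/
def cosetAction {k : Type u} {L : Type v} [Field k] [Field L] [Algebra k L]
    (F : IntermediateField k L) :
    Gal(L/k) →* Equiv.Perm (Gal(L/k) ⧸ F.fixingSubgroup) :=
  MulAction.toPermHom _ _

/-- For `L/k` finite Galois and an intermediate field `F`: `F/k` is almost classically Galois, that
is, some regular subgroup `N` of `Sym(G/G')` is normalized by `λ(G)` and contained in `λ(G)`.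
Here `L` may be the Galois closure of `F/k` or any larger finite Galois extension of `k`: the set
`G/G'` and the group `λ(G)` of its permutations are the same for all of them. -/
def IsAlmostClassicallyGalois {k : Type u} {L : Type v} [Field k] [Field L] [Algebra k L]
    (F : IntermediateField k L) : Prop :=
  ∃ N : Subgroup (Equiv.Perm (Gal(L/k) ⧸ F.fixingSubgroup)),
    IsRegularPermGroup N ∧
    (cosetAction F).range ≤ Subgroup.normalizer (N : Set (Equiv.Perm _)) ∧
    N ≤ (cosetAction F).range

/-- The transitive permutation group `F₃₆:2` of degree 6 and order 72 (number 6T13), also written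
`[S₃²]2` or `S₃ ≀ S₂`: all permutations of six points that preserve a partition of them into two
blocks of size three.  The six points are the pairs in `Fin 2 × Fin 3`, and two of them lie in the
same block when they have the same first coordinate. -/
def F36colon2 : Subgroup (Equiv.Perm (Fin 2 × Fin 3)) where
  carrier := {σ | ∀ x y, (σ x).1 = (σ y).1 ↔ x.1 = y.1}
  mul_mem' := by
    intro a b ha hb x y
    exact (ha (b x) (b y)).trans (hb x y)
  one_mem' := by
    intro x y
    rfl
  inv_mem' := by
    intro a ha x y
    have h := ha (a⁻¹ x) (a⁻¹ y)
    simpa using h.symm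

open scoped Classical in
/-- `τ` is a transposition when `Gal(L/k)` is viewed as a group of permutations of `G/G'`, where
`G' = Gal(L/K)`; for `K/k` of degree `6` this is a transposition in `Sym(G/G') ≃ S₆`. -/
def IsTranspositionOn {k : Type u} {L : Type v} [Field k] [Field L] [Algebra k L]
    (K : IntermediateField k L) (τ : Gal(L/k)) : Prop :=
  (cosetAction K τ).IsSwap

/-! Write `G` for the Galois group and `V` for `Gal(L/F)`. The bridge to group theory is the
Greither–Pareigis correspondence: `F/k` is Hopf Galois exactly when `Sym(G/V)` has a regular
subgroup `N` normalized by `λ(G)`. From `N` one obtains `H` as the `G`-invariants of `L[N]`, by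
Galois descent. Conversely, `N` consists of the permutations of the embeddings `F → L` induced by
the group-like elements of `L ⊗ H`. Bijectivity of `j` corresponds to regularity through Dedekind's
independence of embeddings.

What remains concerns `G = S₃ ≀ S₂`, of order 72. Let `P` be the group of translations inside the
two blocks, of order 9. Every nontrivial normal subgroup of `G` contains `P`, and `G/P` is not
abelian.

Degrees 12 and 24: `G` acts on `N` by conjugation. A group of order 9 has no faithful outer action
on a group of order 12 or 24, so some nontrivial element of `P`, hence by minimality all of `P`,
acts by inner automorphisms. If `G` acts faithfully, `P` embeds in `Inn N`; otherwise `P`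
centralizes the regular group `N` and so embeds in `N`. Either way 9 divides `|N|`, which is false.

Degree 18: `V` has order 4 and is normal in a Sylow 2-subgroup `D`, a complement of `P`. Left
translations by `P` and right translations by `D` form a regular group. A regular group inside
`λ(G)` would instead give a normal complement `M` of `V`; then `M/P` has order 2 and is central, `V`
is abelian, and `G/P` would be abelian.

Transpositions: the even permutations in `G` form a normal complement of the subgroup generated by
an odd involution. Transpositions exist because `G`, in its action on six points, is the full
stabilizer of the two `P`-orbits. -/

/-! ### Galois descent for spaces of functions on a finite `Gal(L/k)`-set -/

section Forms

variable {k : Type*} {L : Type*} [Field k] [Field L] [Algebra k L]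

/-- A `k`-linear embedding of `A` into the functions `S → L` on a `Gal(L/k)`-set `S` whose image
consists of all equivariant functions: it makes `A` a `k`-form of the `L`-space `S → L`. -/
structure IsForm {S A : Type*} [MulAction Gal(L/k) S] [AddCommGroup A] [Module k A]
    (α : A →ₗ[k] (S → L)) : Prop where
  injective : Function.Injective α
  equivariant : ∀ a (g : Gal(L/k)) s, α a (g • s) = g (α a s)
  exists_eq : ∀ f : S → L, (∀ (g : Gal(L/k)) s, f (g • s) = g (f s)) → ∃ a, α a = f

/-- The function on `S × T` attached to a tensor, for `A` and `B` mapping to functions on `S`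
and `T`. -/
noncomputable def tensorFun {S T A B : Type*} [AddCommGroup A] [Module k A] [AddCommGroup B]
    [Module k B] (α : A →ₗ[k] (S → L)) (β : B →ₗ[k] (T → L)) : A ⊗[k] B →ₗ[k] (S × T → L) :=
  TensorProduct.lift (LinearMap.mk₂ k (fun a b p => α a p.1 * β b p.2)
    (by intros; funext p; simp [add_mul]) (by intros; funext p; simp)
    (by intros; funext p; simp [mul_add]) (by intros; funext p; simp))

@[simp]
theorem tensorFun_tmul {S T A B : Type*} [AddCommGroup A] [Module k A] [AddCommGroup B]
    [Module k B] (α : A →ₗ[k] (S → L)) (β : B →ₗ[k] (T → L)) (a : A) (b : B) (p : S × T) :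
    tensorFun α β (a ⊗ₜ b) p = α a p.1 * β b p.2 := rfl

theorem exists_algebraMap_eq_of_fixed [FiniteDimensional k L] [IsGalois k L] {x : L}
    (h : ∀ g : Gal(L/k), g x = x) :
    ∃ c : k, algebraMap k L c = x :=
  (IsGalois.mem_range_algebraMap_iff_fixed x).2 h

namespace IsForm

variable {S T A B : Type*} [MulAction Gal(L/k) S] [MulAction Gal(L/k) T]
  [AddCommGroup A] [Module k A] [AddCommGroup B] [Module k B]
  {α : A →ₗ[k] (S → L)} {β : B →ₗ[k] (T → L)}

/-- Suppose a functional `φ` kills the image. The image contains each trace `∑ g, g(l) δ_{g s₀}`, so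
`∑ g, g(l) φ(δ_{g s₀}) = 0` for all `l`. Dedekind's independence of automorphisms then gives `φ(δ_{g
s₀}) = 0` for every `g`, in particular for `g = 1`. -/
theorem span_range [FiniteDimensional k L] [Finite S] (h : IsForm α) :
    Submodule.span L (Set.range α) = ⊤ := by
  classical
  have := Fintype.ofFinite S
  by_contra hne
  obtain ⟨φ, hφ, hle⟩ := Submodule.exists_le_ker_of_lt_top _ (lt_top_iff_ne_top.2 hne)
  apply hφ
  refine (Pi.basisFun L S).ext fun s₀ => ?_
  have hexp : ∀ f : S → L, φ f = ∑ s, f s * φ (Pi.single s 1) := by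
    intro f
    conv_lhs => rw [pi_eq_sum_univ' f]
    simp only [map_sum, map_smul, smul_eq_mul]
  have hli := linearIndependent_algHom_toLinearMap k L L
  have hli' := hli.comp (fun g : Gal(L/k) => (g : L →ₐ[k] L)) AlgEquiv.coe_toAlgHom_injective
  rw [Fintype.linearIndependent_iff] at hli'
  have key := hli' (fun g => φ (Pi.single (g • s₀) 1)) (by
    ext l
    obtain ⟨a, ha⟩ := h.exists_eq
      (fun s => ∑ g : Gal(L/k), if g • s₀ = s then g l else 0) (by
        intro g s
        rw [map_sum, ← Equiv.sum_comp (Equiv.mulLeft g)]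
        refine Finset.sum_congr rfl fun x _ => ?_
        simp only [Equiv.coe_mulLeft, mul_smul, smul_left_cancel_iff, AlgEquiv.mul_apply]
        split_ifs <;> simp)
    have hz : φ (α a) = 0 := hle (Submodule.subset_span ⟨a, rfl⟩)
    rw [hexp, ha] at hz
    simp only [Finset.sum_mul] at hz
    rw [Finset.sum_comm] at hz
    simp only [ite_mul, zero_mul, Finset.sum_ite_eq, Finset.mem_univ, if_true] at hz
    simpa [mul_comm] using hz)
  simpa using key 1

variable [FiniteDimensional k L] [IsGalois k L]

/-- An `L`-basis can be chosen inside the image, since the image spans. The coordinates of an image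
point are Galois invariant by equivariance, hence lie in `k`, so the preimages of the basis already
span over `k`. -/
theorem exists_basis [Finite S] (h : IsForm α) :
    ∃ (n : ℕ) (a : Module.Basis (Fin n) k A) (e : Module.Basis (Fin n) L (S → L)),
      ∀ i, e i = α (a i) := by
  obtain ⟨b, hb, hspan, hli⟩ := exists_linearIndependent L (Set.range α)
  rw [h.span_range] at hspan
  let e₀ : Module.Basis b L (S → L) := Module.Basis.mk hli (by simp [hspan])
  have : Finite b := Module.Finite.finite_basis e₀
  choose a₀ ha₀ using fun i : b => hb i.2
  let r := Finite.equivFin b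
  let e := e₀.reindex r
  let a := a₀ ∘ r.symm
  have hea : ∀ i, e i = α (a i) := fun i => by
    rw [e₀.reindex_apply, Module.Basis.mk_apply]
    exact (ha₀ _).symm
  have hlia : LinearIndependent k a := by
    refine LinearIndependent.of_comp α ?_
    have : α ∘ a = e := funext fun i => (hea i).symm
    rw [this]
    exact e.linearIndependent.restrict_scalars' k
  suffices hsp : ⊤ ≤ Submodule.span k (Set.range a) from
    ⟨Nat.card b, Module.Basis.mk hlia hsp, e, fun i => by rw [Module.Basis.mk_apply, hea]⟩
  intro x _
  have hfix : ∀ i, ∀ g : Gal(L/k), g (e.repr (α x) i) = e.repr (α x) i := by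
    intro i g
    have h1 : α x = ∑ i, g (e.repr (α x) i) • e i := by
      funext s
      have h2 := congrFun (e.sum_repr (α x)) (g⁻¹ • s)
      simp only [Finset.sum_apply, Pi.smul_apply, smul_eq_mul, hea] at h2 ⊢
      have h3 := congrArg g h2
      rw [← h.equivariant, smul_inv_smul, map_sum] at h3
      rw [← h3]
      refine Finset.sum_congr rfl fun j _ => ?_
      rw [map_mul, ← h.equivariant, smul_inv_smul]
    have h2 := congrArg (fun y => e.repr y i) h1
    simpa only [e.repr_sum_self] using h2.symm
  choose c hc using fun i => exists_algebraMap_eq_of_fixed (hfix i)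
  have hx : x = ∑ i, c i • a i := by
    apply h.injective
    rw [map_sum]
    conv_lhs => rw [← e.sum_repr (α x)]
    refine Finset.sum_congr rfl fun i _ => ?_
    rw [map_smul, hea, ← hc, algebraMap_smul]
  rw [hx]
  exact Submodule.sum_mem _ fun i _ => Submodule.smul_mem _ _ (Submodule.subset_span ⟨i, rfl⟩)

theorem finrank_eq [Finite S] (h : IsForm α) : Module.finrank k A = Nat.card S := by
  have := Fintype.ofFinite S
  obtain ⟨n, a, e, -⟩ := h.exists_basis
  rw [Module.finrank_eq_card_basis a, ← Module.finrank_eq_card_basis e]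
  simp

theorem finite [Finite S] (h : IsForm α) : Module.Finite k A := by
  obtain ⟨n, a, e, -⟩ := h.exists_basis
  exact Module.Finite.of_basis a

end IsForm

/-- Tensors are expanded along a basis of the first factor that is also an `L`-basis of `S → L`. The
coordinates of `f(·, t)` are equivariant functions of `t` when `f` is equivariant, so they come from
`B`. -/
theorem IsForm.tensorFun [FiniteDimensional k L] [IsGalois k L]
    {S T A B : Type*} [MulAction Gal(L/k) S] [MulAction Gal(L/k) T]
    [AddCommGroup A] [Module k A] [AddCommGroup B] [Module k B]
    {α : A →ₗ[k] (S → L)} {β : B →ₗ[k] (T → L)} [Finite S] (hα : IsForm α) (hβ : IsForm β) :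
    IsForm (tensorFun α β) := by
  obtain ⟨n, a, e, he⟩ := hα.exists_basis
  have hw : ∀ w : A ⊗[k] B, ∃ b : Fin n → B, w = ∑ i, a i ⊗ₜ b i := by
    intro w
    induction w with
    | zero => exact ⟨0, by simp⟩
    | tmul x y =>
      refine ⟨fun i => a.repr x i • y, ?_⟩
      conv_lhs => rw [← a.sum_repr x, TensorProduct.sum_tmul]
      simp only [TensorProduct.smul_tmul]
    | add x y hx hy =>
      obtain ⟨b, rfl⟩ := hx
      obtain ⟨c, rfl⟩ := hy
      exact ⟨b + c, by simp [TensorProduct.tmul_add, Finset.sum_add_distrib]⟩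
  refine ⟨?_, ?_, ?_⟩
  · rw [injective_iff_map_eq_zero]
    intro w hw0
    obtain ⟨b, rfl⟩ := hw w
    refine Finset.sum_eq_zero fun i _ => ?_
    have hb : b i = 0 := by
      apply hβ.injective
      rw [map_zero]
      funext t
      have h1 : ∑ i, β (b i) t • e i = 0 := by
        funext s
        have := congrFun hw0 (s, t)
        simpa [he, mul_comm] using this
      exact Fintype.linearIndependent_iff.1 e.linearIndependent _ h1 i
    rw [hb, TensorProduct.tmul_zero]
  · intro w g p
    obtain ⟨b, rfl⟩ := hw w
    simp [hα.equivariant, hβ.equivariant]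
  · intro f hf
    have hc : ∀ i, ∃ b : B, β b = fun t => e.repr (fun s => f (s, t)) i := by
      intro i
      refine hβ.exists_eq _ fun g t => ?_
      have h1 : (fun s => f (s, g • t)) = ∑ i, g (e.repr (fun s => f (s, t)) i) • e i := by
        funext s
        have h2 := congrFun (e.sum_repr (fun s => f (s, t))) (g⁻¹ • s)
        simp only [Finset.sum_apply, Pi.smul_apply, smul_eq_mul, he] at h2 ⊢
        have h3 := congrArg g h2
        rw [← hf, map_sum, Prod.smul_mk, smul_inv_smul] at h3
        rw [← h3]
        refine Finset.sum_congr rfl fun j _ => ?_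
        rw [map_mul, ← hα.equivariant, smul_inv_smul]
      rw [h1]
      simp [Finsupp.single_apply]
    choose b hb using hc
    refine ⟨∑ i, a i ⊗ₜ b i, ?_⟩
    funext p
    have h2 := congrFun (e.sum_repr (fun s => f (s, p.2))) p.1
    simp only [Finset.sum_apply, Pi.smul_apply, smul_eq_mul, he] at h2
    rw [map_sum, Finset.sum_apply]
    simp only [tensorFun_tmul, hb]
    rw [← h2]
    exact Finset.sum_congr rfl fun i _ => mul_comm _ _

end Forms

/-! ### The Hopf algebra structure on a form of `L[N]` -/

section GroupForms

variable {k : Type*} {L : Type*} [Field k] [Field L] [Algebra k L]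

namespace IsForm

variable {T A B : Type*} [MulAction Gal(L/k) T]
  [AddCommGroup A] [Module k A] [AddCommGroup B] [Module k B] {β : B →ₗ[k] (T → L)}

/-- A linear map into equivariant functions on `T` lifts to any form of `T → L`. -/
noncomputable def lift (h : IsForm β) (D : A →ₗ[k] (T → L))
    (hD : ∀ a (g : Gal(L/k)) t, D a (g • t) = g (D a t)) : A →ₗ[k] B where
  toFun a := (h.exists_eq (D a) (hD a)).choose
  map_add' a b := h.injective <| by
    rw [map_add β]
    exact (h.exists_eq _ (hD (a + b))).choose_spec.trans ((map_add D a b).trans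
      (congrArg₂ (· + ·) (h.exists_eq _ (hD a)).choose_spec.symm
        (h.exists_eq _ (hD b)).choose_spec.symm))
  map_smul' c a := h.injective <| by
    rw [map_smul β]
    exact (h.exists_eq _ (hD (c • a))).choose_spec.trans ((map_smul D c a).trans
      (congrArg (c • ·) (h.exists_eq _ (hD a)).choose_spec.symm))

theorem lift_apply (h : IsForm β) (D : A →ₗ[k] (T → L))
    (hD : ∀ a (g : Gal(L/k)) t, D a (g • t) = g (D a t)) (a : A) : β (h.lift D hD a) = D a :=
  (h.exists_eq (D a) (hD a)).choose_spec

end IsForm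

/-- `H` is a `k`-form of the group algebra `L[N]`, whose elements are described by their
coefficient functions `N → L`. -/
structure IsGroupForm {N H : Type*} [Group N] [Fintype N] [DecidableEq N]
    [MulDistribMulAction Gal(L/k) N] [Ring H] [Algebra k H] (ι : H →ₗ[k] (N → L)) : Prop
    extends IsForm ι where
  map_one : ι 1 = Pi.single 1 1
  map_mul : ∀ a b n, ι (a * b) n = ∑ q, ι a (n * q⁻¹) * ι b q

namespace IsGroupForm

variable {N H : Type*} [Group N] [Fintype N] [DecidableEq N] [MulDistribMulAction Gal(L/k) N]
  [Ring H] [Algebra k H] {ι : H →ₗ[k] (N → L)}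

theorem tensorFun_mul (h : IsGroupForm ι) (w z : H ⊗[k] H) (n m : N) :
    tensorFun ι ι (w * z) (n, m) =
      ∑ p, ∑ q, tensorFun ι ι w (n * p⁻¹, m * q⁻¹) * tensorFun ι ι z (p, q) := by
  induction w with
  | zero => simp
  | add x y hx hy =>
    rw [add_mul, map_add, Pi.add_apply, hx, hy]
    simp only [map_add, Pi.add_apply, add_mul, Finset.sum_add_distrib]
  | tmul a b =>
    induction z with
    | zero => simp
    | add x y hx hy =>
      rw [mul_add, map_add, Pi.add_apply, hx, hy]
      simp only [map_add, Pi.add_apply, mul_add, Finset.sum_add_distrib]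
    | tmul c d =>
      simp only [Algebra.TensorProduct.tmul_mul_tmul, tensorFun_tmul, h.map_mul,
        Finset.sum_mul_sum]
      exact Finset.sum_congr rfl fun p _ => Finset.sum_congr rfl fun q _ => by ring

/-- The antipode: it moves the coefficient of `n` to `n⁻¹`. -/
noncomputable def antipode (h : IsGroupForm ι) : H →ₗ[k] H :=
  h.toIsForm.lift
    { toFun := fun a n => ι a n⁻¹
      map_add' := fun a b => by funext; simp
      map_smul' := fun c a => by funext; simp }
    (fun a g n => by simp [← h.equivariant])

theorem apply_antipode (h : IsGroupForm ι) (a : H) (n : N) : ι (h.antipode a) n = ι a n⁻¹ :=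
  congrFun (h.toIsForm.lift_apply _ _ a) n

variable [FiniteDimensional k L] [IsGalois k L]

/-- The comultiplication: it puts the coefficients on the diagonal of `N × N`. -/
noncomputable def comul (h : IsGroupForm ι) : H →ₗ[k] H ⊗[k] H :=
  (h.toIsForm.tensorFun h.toIsForm).lift
    { toFun := fun a p => if p.1 = p.2 then ι a p.1 else 0
      map_add' := fun a b => by funext p; by_cases hp : p.1 = p.2 <;> simp [hp]
      map_smul' := fun c a => by funext p; by_cases hp : p.1 = p.2 <;> simp [hp] }
    (fun a g p => by
      by_cases hp : p.1 = p.2 <;> simp [hp, h.equivariant])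

theorem tensorFun_comul (h : IsGroupForm ι) (a : H) (n m : N) :
    tensorFun ι ι (h.comul a) (n, m) = if n = m then ι a n else 0 :=
  congrFun ((h.toIsForm.tensorFun h.toIsForm).lift_apply _ _ a) (n, m)

theorem exists_sum_eq (h : IsGroupForm ι) (a : H) : ∃ c : k, algebraMap k L c = ∑ n, ι a n := by
  refine exists_algebraMap_eq_of_fixed fun g => ?_
  rw [map_sum, ← Equiv.sum_comp (MulAction.toPerm g) (fun n => ι a n)]
  exact Finset.sum_congr rfl fun n _ => (h.equivariant a g n).symm

/-- The counit: the sum of all coefficients. -/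
noncomputable def counit (h : IsGroupForm ι) : H →ₗ[k] k where
  toFun a := (h.exists_sum_eq a).choose
  map_add' a b := (algebraMap k L).injective <| by
    refine (h.exists_sum_eq (a + b)).choose_spec.trans ?_
    rw [_root_.map_add (algebraMap k L), (h.exists_sum_eq a).choose_spec,
      (h.exists_sum_eq b).choose_spec]
    simp [Finset.sum_add_distrib]
  map_smul' c a := (algebraMap k L).injective <| by
    refine (h.exists_sum_eq (c • a)).choose_spec.trans ?_
    rw [smul_eq_mul, _root_.map_mul (algebraMap k L), RingHom.id_apply,
      (h.exists_sum_eq a).choose_spec, map_smul, Finset.mul_sum]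
    simp only [Pi.smul_apply, Algebra.smul_def]

theorem algebraMap_counit (h : IsGroupForm ι) (a : H) :
    algebraMap k L (h.counit a) = ∑ n, ι a n :=
  (h.exists_sum_eq a).choose_spec

/-- Coefficient maps of tensor powers are injective, so coassociativity can be checked on functions
on `N × N × N`; this formula and the next compute its two sides. -/
theorem tensorFun_assoc_rTensor_comul (h : IsGroupForm ι) (w : H ⊗[k] H) (n m r : N) :
    tensorFun ι (tensorFun ι ι) (TensorProduct.assoc k H H H (h.comul.rTensor H w)) (n, m, r) =
      if n = m then tensorFun ι ι w (n, r) else 0 := by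
  induction w with
  | zero => simp
  | add x y hx hy =>
    rw [map_add, map_add, map_add, Pi.add_apply, hx, hy]
    split_ifs <;> simp
  | tmul a b =>
    have key : ∀ z : H ⊗[k] H,
        tensorFun ι (tensorFun ι ι) (TensorProduct.assoc k H H H (z ⊗ₜ b)) (n, m, r) =
          tensorFun ι ι z (n, m) * ι b r := by
      intro z
      induction z with
      | zero => simp
      | add x y hx hy =>
        rw [TensorProduct.add_tmul, map_add, map_add, Pi.add_apply, hx, hy, map_add, Pi.add_apply,
          add_mul]
      | tmul c d => simp [mul_assoc]
    rw [LinearMap.rTensor_tmul, key, tensorFun_comul]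
    split_ifs <;> simp

theorem tensorFun_lTensor_comul (h : IsGroupForm ι) (w : H ⊗[k] H) (n m r : N) :
    tensorFun ι (tensorFun ι ι) (h.comul.lTensor H w) (n, m, r) =
      if m = r then tensorFun ι ι w (n, m) else 0 := by
  induction w with
  | zero => simp
  | add x y hx hy =>
    rw [map_add, map_add, Pi.add_apply, hx, hy]
    split_ifs <;> simp
  | tmul a b =>
    rw [LinearMap.lTensor_tmul, tensorFun_tmul, tensorFun_comul]
    split_ifs <;> simp

theorem lid_rTensor_counit (h : IsGroupForm ι) (w : H ⊗[k] H) (n : N) :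
    ι (TensorProduct.lid k H (h.counit.rTensor H w)) n = ∑ m, tensorFun ι ι w (m, n) := by
  induction w with
  | zero => simp
  | add x y hx hy => simp [hx, hy, Finset.sum_add_distrib]
  | tmul a b => 
    simp only [LinearMap.rTensor_tmul, TensorProduct.lid_tmul, map_smul, tensorFun_tmul,
      ← Finset.sum_mul, ← h.algebraMap_counit, Pi.smul_apply]
    rw [Algebra.smul_def]

theorem rid_lTensor_counit (h : IsGroupForm ι) (w : H ⊗[k] H) (n : N) :
    ι (TensorProduct.rid k H (h.counit.lTensor H w)) n = ∑ m, tensorFun ι ι w (n, m) := by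
  induction w with
  | zero => simp
  | add x y hx hy => simp [hx, hy, Finset.sum_add_distrib]
  | tmul a b => 
    simp only [LinearMap.lTensor_tmul, TensorProduct.rid_tmul, map_smul, tensorFun_tmul,
      ← Finset.mul_sum, ← h.algebraMap_counit, Pi.smul_apply]
    rw [Algebra.smul_def, mul_comm]

/-- A form of a group algebra is a coalgebra. -/
@[reducible]
noncomputable def coalgebra (h : IsGroupForm ι) : Coalgebra k H where
  comul := h.comul
  counit := h.counit
  coassoc := by
    ext a
    apply (h.toIsForm.tensorFun (h.toIsForm.tensorFun h.toIsForm)).injective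
    funext ⟨n, m, r⟩
    simp only [LinearMap.comp_apply, LinearEquiv.coe_coe, tensorFun_assoc_rTensor_comul,
      tensorFun_lTensor_comul, tensorFun_comul]
    by_cases h1 : n = m <;> by_cases h2 : m = r <;> simp_all
  rTensor_counit_comp_comul := by
    ext a
    apply (TensorProduct.lid k H).injective
    apply h.injective
    funext n
    rw [LinearMap.comp_apply, lid_rTensor_counit]
    simp [tensorFun_comul]
  lTensor_counit_comp_comul := by
    ext a
    apply (TensorProduct.rid k H).injective
    apply h.injective
    funext n
    rw [LinearMap.comp_apply, rid_lTensor_counit]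
    simp [tensorFun_comul]

/-- A form of a group algebra is a bialgebra. -/
@[reducible]
noncomputable def bialgebra (h : IsGroupForm ι) : Bialgebra k H :=
  letI := h.coalgebra
  Bialgebra.mk' k H
    (by
      apply (algebraMap k L).injective
      change algebraMap k L (h.counit 1) = _
      simp [h.algebraMap_counit, h.map_one])
    (by
      intro a b
      apply (algebraMap k L).injective
      change algebraMap k L (h.counit (a * b)) = algebraMap k L (h.counit a * h.counit b)
      simp only [_root_.map_mul, h.algebraMap_counit, h.map_mul]
      rw [Finset.sum_comm, Finset.mul_sum]
      refine Finset.sum_congr rfl fun q _ => ?_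
      rw [← Finset.sum_mul, ← Equiv.sum_comp (Equiv.mulRight q)]
      simp)
    (by
      apply (h.toIsForm.tensorFun h.toIsForm).injective
      funext ⟨n, m⟩
      change tensorFun ι ι (h.comul 1) (n, m) = _
      rw [h.tensorFun_comul, Algebra.TensorProduct.one_def, tensorFun_tmul, h.map_one]
      simp only [Pi.single_apply]
      by_cases h1 : n = 1 <;> by_cases h2 : m = 1 <;> simp_all [eq_comm])
    (by
      intro a b
      apply (h.toIsForm.tensorFun h.toIsForm).injective
      funext ⟨n, m⟩
      change tensorFun ι ι (h.comul (a * b)) (n, m) =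
        tensorFun ι ι (h.comul a * h.comul b) (n, m)
      simp only [h.tensorFun_comul, h.tensorFun_mul, h.map_mul]
      by_cases h1 : n = m <;> simp [h1])

/-- A form of a group algebra is a Hopf algebra. -/
@[reducible]
noncomputable def hopfAlgebra (h : IsGroupForm ι) : HopfAlgebra k H where
  __ := h.bialgebra
  antipode := h.antipode
  mul_antipode_rTensor_comul := by
    have key : ∀ (w : H ⊗[k] H) n, ι (LinearMap.mul' k H (h.antipode.rTensor H w)) n =
        ∑ q, tensorFun ι ι w ((n * q⁻¹)⁻¹, q) := by
      intro w n
      induction w with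
      | zero => simp
      | add x y hx hy => simp only [map_add, Pi.add_apply, hx, hy, Finset.sum_add_distrib]
      | tmul a b => simp [h.map_mul, apply_antipode]
    ext a
    apply h.injective
    funext n
    change ι (LinearMap.mul' k H (h.antipode.rTensor H (h.comul a))) n =
      ι (algebraMap k H (h.counit a)) n
    rw [key, Algebra.algebraMap_eq_smul_one, map_smul, h.map_one, Pi.smul_apply,
      Algebra.smul_def, h.algebraMap_counit]
    by_cases h1 : n = 1 <;> simp [h1, tensorFun_comul]
  mul_antipode_lTensor_comul := by
    have key : ∀ (w : H ⊗[k] H) n, ι (LinearMap.mul' k H (h.antipode.lTensor H w)) n =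
        ∑ q, tensorFun ι ι w (n * q⁻¹, q⁻¹) := by
      intro w n
      induction w with
      | zero => simp
      | add x y hx hy => simp only [map_add, Pi.add_apply, hx, hy, Finset.sum_add_distrib]
      | tmul a b => simp [h.map_mul, apply_antipode]
    ext a
    apply h.injective
    funext n
    change ι (LinearMap.mul' k H (h.antipode.lTensor H (h.comul a))) n =
      ι (algebraMap k H (h.counit a)) n
    rw [key, Algebra.algebraMap_eq_smul_one, map_smul, h.map_one, Pi.smul_apply,
      Algebra.smul_def, h.algebraMap_counit, ← Equiv.sum_comp (Equiv.inv N) (fun n => ι a n)]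
    by_cases h1 : n = 1 <;> simp [h1, tensorFun_comul]

/-- The comultiplication is supported on the diagonal of `N × N`, which the flip fixes. -/
theorem isCocomm (h : IsGroupForm ι) : letI := h.coalgebra; Coalgebra.IsCocomm k H := by
  let := h.coalgebra
  refine ⟨?_⟩
  have key : ∀ (w : H ⊗[k] H) n m, tensorFun ι ι (TensorProduct.comm k H H w) (n, m) =
      tensorFun ι ι w (m, n) := by
    intro w n m
    induction w with
    | zero => simp
    | add x y hx hy => simp only [map_add, Pi.add_apply, hx, hy]
    | tmul a b => simp [mul_comm]
  ext a
  apply (h.toIsForm.tensorFun h.toIsForm).injective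
  funext ⟨n, m⟩
  change tensorFun ι ι (TensorProduct.comm k H H (h.comul a)) (n, m) =
    tensorFun ι ι (h.comul a) (n, m)
  rw [key, tensorFun_comul, tensorFun_comul]
  by_cases h1 : n = m
  · simp [h1]
  · simp [h1, Ne.symm h1]

end IsGroupForm

end GroupForms

/-! ### Existence of a form of `L[N]` -/

section GroupAlgebraForm

variable (k : Type*) (L : Type*) [Field k] [Field L] [Algebra k L]
  (N : Type*) [Group N] [Fintype N] [DecidableEq N] [MulDistribMulAction Gal(L/k) N]

/-- The `k`-algebra of `Gal(L/k)`-invariants of the group algebra `L[N]`, whose elements are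
written as matrices over `L` that are invariant under right translation by `N`. -/
def invariantGroupAlgebra : Subalgebra k (Matrix N N L) where
  carrier := {M | (∀ (g : Gal(L/k)) n m, M (g • n) (g • m) = g (M n m)) ∧
    ∀ n m r, M (n * r) (m * r) = M n m}
  mul_mem' := by
    rintro M M' ⟨h1, h2⟩ ⟨h1', h2'⟩
    refine ⟨fun g n m => ?_, fun n m r => ?_⟩
    · rw [Matrix.mul_apply, Matrix.mul_apply, map_sum, ← Equiv.sum_comp (MulAction.toPerm g)]
      simp [h1, h1']
    · rw [Matrix.mul_apply, Matrix.mul_apply, ← Equiv.sum_comp (Equiv.mulRight r)]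
      simp [h2, h2']
  add_mem' := by
    rintro M M' ⟨h1, h2⟩ ⟨h1', h2'⟩
    exact ⟨fun g n m => by simp [h1, h1'], fun n m r => by simp [h2, h2']⟩
  algebraMap_mem' c := by
    refine ⟨fun g n m => ?_, fun n m r => ?_⟩
    · rw [Matrix.algebraMap_matrix_apply, Matrix.algebraMap_matrix_apply]
      by_cases h : n = m <;> simp [h]
    · rw [Matrix.algebraMap_matrix_apply, Matrix.algebraMap_matrix_apply]
      by_cases h : n = m <;> simp [h]

/-- The coefficients of an element of the invariant group algebra. -/
def invariantGroupAlgebraCoeff : invariantGroupAlgebra k L N →ₗ[k] (N → L) where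
  toFun M n := M.1 n 1
  map_add' _ _ := rfl
  map_smul' _ _ := rfl

/-- A matrix invariant under right translation has entries `f(n m⁻¹)`, where `f` is its column at
`1`. Matrix multiplication becomes convolution of these columns. -/
theorem isGroupForm_invariantGroupAlgebraCoeff :
    IsGroupForm (invariantGroupAlgebraCoeff k L N) where
  injective := by
    intro M M' h
    apply Subtype.ext
    ext n m
    have h1 := congrFun h (n * m⁻¹)
    have h2 := M.2.2 (n * m⁻¹) 1 m
    have h3 := M'.2.2 (n * m⁻¹) 1 m
    rw [inv_mul_cancel_right, one_mul] at h2 h3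
    rw [h2, h3]
    exact h1
  equivariant M g n := by
    have := M.2.1 g n 1
    rwa [smul_one] at this
  exists_eq f hf := by
    refine ⟨⟨fun n m => f (n * m⁻¹), fun g n m => ?_, fun n m r => ?_⟩, ?_⟩
    · change f (g • n * (g • m)⁻¹) = g (f (n * m⁻¹))
      rw [← smul_inv', ← smul_mul', hf]
    · simp
    · funext n
      change f (n * 1⁻¹) = f n
      simp
  map_one := by
    funext n
    change (1 : Matrix N N L) n 1 = _
    rw [Matrix.one_apply, Pi.single_apply]
  map_mul M M' n := by
    change (M.1 * M'.1) n 1 = ∑ q, M.1 (n * q⁻¹) 1 * M'.1 q 1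
    rw [Matrix.mul_apply]
    refine Finset.sum_congr rfl fun q _ => ?_
    have h2 := M.2.2 (n * q⁻¹) 1 q
    rw [inv_mul_cancel_right, one_mul] at h2
    rw [h2]

variable {k L N}

theorem IsGroupForm.comp_algEquiv {H H' : Type*} [Ring H] [Algebra k H] [Ring H'] [Algebra k H']
    {ι : H →ₗ[k] (N → L)} (h : IsGroupForm ι) (e : H' ≃ₐ[k] H) :
    IsGroupForm (ι ∘ₗ e.toLinearMap) where
  injective := h.injective.comp e.injective
  equivariant a := h.equivariant (e a)
  exists_eq f hf := by
    obtain ⟨a, rfl⟩ := h.exists_eq f hf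
    exact ⟨e.symm a, by simp⟩
  map_one := by simpa using h.map_one
  map_mul a b n := by simpa using h.map_mul (e a) (e b) n

theorem exists_isGroupForm (k : Type u) (L : Type v) [Field k] [Field L] [Algebra k L]
    [FiniteDimensional k L] [IsGalois k L]
    (N : Type*) [Group N] [Fintype N] [DecidableEq N] [MulDistribMulAction Gal(L/k) N] :
    ∃ (H : Type u) (_ : Ring H) (_ : Algebra k H) (ι : H →ₗ[k] (N → L)), IsGroupForm ι := by
  have h := isGroupForm_invariantGroupAlgebraCoeff k L N
  have := h.toIsForm.finite
  -- The matrices need not live in the universe of `k`, but a finite-dimensional `k`-space is in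
  -- bijection with some `Fin n → k`.
  have : Small.{u} (invariantGroupAlgebra k L N) :=
    small_map (Module.finBasis k (invariantGroupAlgebra k L N)).equivFun.toEquiv
  exact ⟨Shrink.{u} (invariantGroupAlgebra k L N), inferInstance, inferInstance, _,
    h.comp_algEquiv (Shrink.algEquiv k _)⟩

end GroupAlgebraForm

/-! ### Cosets of `Gal(L/F)` as embeddings of `F` -/

section CosetEmb

variable {k : Type*} {L : Type*} [Field k] [Field L] [Algebra k L] (F : IntermediateField k L)

/-- The `k`-embedding `F → L` given by a coset of `Gal(L/F)`. -/
def cosetEmb (x : Gal(L/k) ⧸ F.fixingSubgroup) : F →ₐ[k] L :=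
  Quotient.liftOn' x (fun g => (g : L →ₐ[k] L).comp F.val) (by
    intro g g' h
    rw [QuotientGroup.leftRel_apply] at h
    ext a
    have h1 := (IntermediateField.mem_fixingSubgroup_iff F _).1 h a a.2
    have h2 := congrArg g h1
    simpa using h2.symm)

@[simp]
theorem cosetEmb_mk (g : Gal(L/k)) (a : F) : cosetEmb F (g : Gal(L/k) ⧸ F.fixingSubgroup) a = g a :=
  rfl

@[simp]
theorem cosetEmb_smul (g : Gal(L/k)) (x : Gal(L/k) ⧸ F.fixingSubgroup) (a : F) :
    cosetEmb F (g • x) a = g (cosetEmb F x a) := by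
  induction x using QuotientGroup.induction_on with
  | H y => rfl

theorem cosetEmb_injective : Function.Injective (cosetEmb F) := by
  intro x y
  induction x using QuotientGroup.induction_on with
  | H x =>
    induction y using QuotientGroup.induction_on with
    | H y =>
      intro h
      rw [QuotientGroup.eq, IntermediateField.mem_fixingSubgroup_iff]
      intro a ha
      have h1 : x a = y a := DFunLike.congr_fun h ⟨a, ha⟩
      rw [AlgEquiv.mul_apply, ← h1]
      exact x.symm_apply_apply a

theorem cosetEmb_surjective [Normal k L] : Function.Surjective (cosetEmb F) := by
  intro φ
  obtain ⟨g, hg⟩ : ∃ g : Gal(L/k), ∀ a : F, g a = φ a := by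
    have h := φ.liftNormal_commutes L
    exact ⟨AlgEquiv.ofBijective (φ.liftNormal L) (AlgHom.normal_bijective k L L _),
      fun a => h a⟩
  exact ⟨g, by ext a; exact hg a⟩

/-- An element of `F` gives the function on cosets whose values are its conjugates. -/
def conjugates : F →ₗ[k] (Gal(L/k) ⧸ F.fixingSubgroup → L) where
  toFun a x := cosetEmb F x a
  map_add' a b := by funext; simp
  map_smul' c a := by funext; simp

@[simp]
theorem conjugates_apply (a : F) (x : Gal(L/k) ⧸ F.fixingSubgroup) :
    conjugates F a x = cosetEmb F x a := rfl

/-- An equivariant function is determined by its value at the trivial coset. That value is fixed by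
`Gal(L/F)`, so it lies in `F`. -/
theorem isForm_conjugates [FiniteDimensional k L] [IsGalois k L] : IsForm (conjugates F) where
  injective := by
    intro a b h
    exact (cosetEmb F ((1 : Gal(L/k)) : Gal(L/k) ⧸ F.fixingSubgroup)).toRingHom.injective
      (congrFun h ((1 : Gal(L/k)) : Gal(L/k) ⧸ F.fixingSubgroup))
  equivariant a g x := cosetEmb_smul F g x a
  exists_eq f hf := by
    have h1 : f ((1 : Gal(L/k)) : Gal(L/k) ⧸ F.fixingSubgroup) ∈
        IntermediateField.fixedField F.fixingSubgroup := by
      rintro ⟨g, hg⟩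
      change g (f _) = _
      rw [← hf]
      congr 1
      rw [MulAction.Quotient.smul_mk, smul_eq_mul, mul_one, QuotientGroup.eq]
      simpa using hg
    rw [IsGalois.fixedField_fixingSubgroup] at h1
    refine ⟨⟨_, h1⟩, ?_⟩
    funext x
    induction x using QuotientGroup.induction_on with
    | H x =>
      change x (f _) = _
      rw [← hf, MulAction.Quotient.smul_mk, smul_eq_mul, mul_one]

end CosetEmb

/-! ### From regular groups to Hopf Galois structures -/

section RegularToHopf

variable {k H : Type u} {L : Type*} [Field k] [Field L] [Algebra k L]
  [FiniteDimensional k L] [IsGalois k L]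
  {N : Type*} [Group N] [Fintype N] [DecidableEq N] [MulDistribMulAction Gal(L/k) N]
  [Ring H] [Algebra k H] {ι : H →ₗ[k] (N → L)}
  (F : IntermediateField k L) [MulAction N (Gal(L/k) ⧸ F.fixingSubgroup)]

namespace IsGroupForm

variable (hcomp : ∀ (g : Gal(L/k)) (n : N) (x : Gal(L/k) ⧸ F.fixingSubgroup),
  g • n • x = (g • n) • g • x)

/-- A form `H` of `L[N]` acts on `F` when `N` permutes the embeddings of `F`. -/
noncomputable def actionAux (h : IsGroupForm ι) (a : H) : F →ₗ[k] F :=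
  (isForm_conjugates F).lift
    -- The inverse makes precomposition with `N` a left action.
    { toFun := fun b x => ∑ n, ι a n * cosetEmb F (n⁻¹ • x) b
      map_add' := fun b c => by funext; simp [mul_add, Finset.sum_add_distrib]
      map_smul' := fun c b => by funext; simp [Finset.smul_sum] }
    (fun b g x => by
      change ∑ n, ι a n * cosetEmb F (n⁻¹ • g • x) b = g (∑ n, ι a n * cosetEmb F (n⁻¹ • x) b)
      rw [map_sum, ← Equiv.sum_comp (MulAction.toPerm g)]
      refine Finset.sum_congr rfl fun n _ => ?_
      rw [MulAction.toPerm_apply, h.equivariant, ← smul_inv', ← hcomp, cosetEmb_smul,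
        _root_.map_mul])

theorem cosetEmb_actionAux (h : IsGroupForm ι) (a : H) (b : F)
    (x : Gal(L/k) ⧸ F.fixingSubgroup) :
    cosetEmb F x (h.actionAux F hcomp a b) = ∑ n, ι a n * cosetEmb F (n⁻¹ • x) b :=
  congrFun ((isForm_conjugates F).lift_apply _ _ b) x

/-- The action of a form of `L[N]` on `F` as an algebra homomorphism. -/
noncomputable def action (h : IsGroupForm ι) : H →ₐ[k] Module.End k F :=
  AlgHom.ofLinearMap
    { toFun := h.actionAux F hcomp
      map_add' := fun a a' => LinearMap.ext fun b => (isForm_conjugates F).injective <| by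
        funext x
        simp [cosetEmb_actionAux, add_mul, Finset.sum_add_distrib]
      map_smul' := fun c a => LinearMap.ext fun b => (isForm_conjugates F).injective <| by
        funext x
        simp [cosetEmb_actionAux, Finset.smul_sum] }
    (LinearMap.ext fun b => (isForm_conjugates F).injective <| by
      funext x
      change cosetEmb F x (h.actionAux F hcomp 1 b) = cosetEmb F x b
      rw [cosetEmb_actionAux, h.map_one]
      simp [Pi.single_apply])
    (fun a a' => LinearMap.ext fun b => (isForm_conjugates F).injective <| by
      funext x
      change cosetEmb F x (h.actionAux F hcomp (a * a') b) =
        cosetEmb F x (h.actionAux F hcomp a (h.actionAux F hcomp a' b))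
      simp only [cosetEmb_actionAux, h.map_mul, Finset.sum_mul, Finset.mul_sum]
      rw [Finset.sum_comm]
      conv_rhs => rw [Finset.sum_comm]
      refine Finset.sum_congr rfl fun q _ => ?_
      rw [← Equiv.sum_comp (Equiv.mulRight q)]
      refine Finset.sum_congr rfl fun n _ => ?_
      simp [mul_assoc, mul_smul])

theorem cosetEmb_action (h : IsGroupForm ι) (a : H) (b : F)
    (x : Gal(L/k) ⧸ F.fixingSubgroup) :
    cosetEmb F x (h.action F hcomp a b) = ∑ n, ι a n * cosetEmb F (n⁻¹ • x) b :=
  h.cosetEmb_actionAux F hcomp a b x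

theorem isModuleAlgebraAction (h : IsGroupForm ι) :
    letI := h.hopfAlgebra; IsModuleAlgebraAction (h.action F hcomp) := by
  let := h.hopfAlgebra
  constructor
  · intro a
    apply (isForm_conjugates F).injective
    funext x
    change cosetEmb F x (h.action F hcomp a 1) = cosetEmb F x (algebraMap k F (h.counit a))
    rw [cosetEmb_action, AlgHom.commutes, h.algebraMap_counit]
    simp
  · intro a b c
    have key : ∀ w : H ⊗[k] H, ∀ x, cosetEmb F x (LinearMap.mul' k F
        (TensorProduct.map ((h.action F hcomp).toLinearMap.flip b)
          ((h.action F hcomp).toLinearMap.flip c) w)) =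
        ∑ n, ∑ m, tensorFun ι ι w (n, m) *
          (cosetEmb F (n⁻¹ • x) b * cosetEmb F (m⁻¹ • x) c) := by
      intro w x
      induction w with
      | zero => simp
      | add w z hw hz => simp only [map_add, hw, hz, Pi.add_apply, add_mul, Finset.sum_add_distrib]
      | tmul a a' =>
        simp only [TensorProduct.map_tmul, LinearMap.flip_apply, AlgHom.toLinearMap_apply,
          LinearMap.mul'_apply, _root_.map_mul, cosetEmb_action, tensorFun_tmul,
          Finset.sum_mul_sum]
        exact Finset.sum_congr rfl fun n _ => Finset.sum_congr rfl fun m _ => by ring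
    apply (isForm_conjugates F).injective
    funext x
    refine Eq.trans ?_ (key (h.comul a) x).symm
    simp [cosetEmb_action, tensorFun_comul]

/-- Regularity gives `|N| = [F:k]`, so both sides have the same dimension and injectivity suffices.
A kernel element yields, for each `x`, a linear relation among the embeddings `n⁻¹ • x`; these are
distinct by regularity, hence linearly independent over `L`. -/
theorem bijective_hopfGaloisMap (h : IsGroupForm ι)
    (hreg : ∀ x y : Gal(L/k) ⧸ F.fixingSubgroup, ∃! n : N, n • x = y) :
    letI := h.hopfAlgebra; Function.Bijective (hopfGaloisMap (h.action F hcomp)) := by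
  let := h.hopfAlgebra
  have := h.toIsForm.finite
  have hcard : Nat.card N = Nat.card (Gal(L/k) ⧸ F.fixingSubgroup) :=
    Nat.card_eq_of_bijective
      (fun n : N => n • ((1 : Gal(L/k)) : Gal(L/k) ⧸ F.fixingSubgroup))
      ⟨fun n m hnm => (hreg _ _).unique hnm rfl, fun y => (hreg _ y).exists⟩
  have hdim : Module.finrank k (F ⊗[k] H) = Module.finrank k (Module.End k F) := by
    rw [Module.finrank_tensorProduct, Module.finrank_linearMap, h.toIsForm.finrank_eq, hcard,
      (isForm_conjugates F).finrank_eq]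
  suffices hinj : Function.Injective (hopfGaloisMap (h.action F hcomp)) from
    ⟨hinj, (LinearMap.injective_iff_surjective_of_finrank_eq_finrank hdim).1 hinj⟩
  have key : ∀ w : F ⊗[k] H, ∀ t x, cosetEmb F x (hopfGaloisMap (h.action F hcomp) w t) =
      ∑ n, tensorFun (conjugates F) ι w (x, n) * cosetEmb F (n⁻¹ • x) t := by
    intro w t x
    induction w with
    | zero => simp
    | add w z hw hz =>
      simp only [map_add, LinearMap.add_apply, hw, hz, Pi.add_apply, add_mul,
        Finset.sum_add_distrib]
    | tmul s a =>
      simp [hopfGaloisMap_tmul, cosetEmb_action, Finset.mul_sum, mul_assoc]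
  rw [injective_iff_map_eq_zero]
  intro w hw
  apply ((isForm_conjugates F).tensorFun h.toIsForm).injective
  rw [map_zero]
  funext ⟨x, n⟩
  have hinj : Function.Injective fun n : N => cosetEmb F (n⁻¹ • x) := by
    intro n m hnm
    exact inv_injective ((hreg x _).unique (cosetEmb_injective F hnm) rfl)
  have hli := (linearIndependent_algHom_toLinearMap k F L).comp _ hinj
  rw [Fintype.linearIndependent_iff] at hli
  refine hli (fun n => tensorFun (conjugates F) ι w (x, n)) ?_ n
  ext t
  have h0 := key w t x
  rw [hw] at h0
  simpa using h0.symm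

end IsGroupForm

end RegularToHopf

/-- If a finite group `N` with an action of `Gal(L/k)` acts compatibly and simply transitively on
the cosets of `Gal(L/F)`, then `F/k` is Hopf Galois. -/
theorem isHopfGalois_of_mulAction {k : Type u} {L : Type v} [Field k] [Field L] [Algebra k L]
    [FiniteDimensional k L] [IsGalois k L] (F : IntermediateField k L)
    {N : Type*} [Group N] [Finite N] [MulDistribMulAction Gal(L/k) N]
    [MulAction N (Gal(L/k) ⧸ F.fixingSubgroup)]
    (hcomp : ∀ (g : Gal(L/k)) (n : N) (x : Gal(L/k) ⧸ F.fixingSubgroup),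
      g • n • x = (g • n) • g • x)
    (hreg : ∀ x y : Gal(L/k) ⧸ F.fixingSubgroup, ∃! n : N, n • x = y) :
    IsHopfGalois k F := by
  classical
  have := Fintype.ofFinite N
  obtain ⟨H, _, _, ι, h⟩ := exists_isGroupForm k L N
  exact ⟨H, _, h.hopfAlgebra, h.toIsForm.finite, h.isCocomm, h.action F hcomp,
    h.isModuleAlgebraAction F hcomp, h.bijective_hopfGaloisMap F hcomp hreg⟩

/-- If some regular group of permutations of the cosets of `Gal(L/F)` is normalized by
`Gal(L/k)`, then `F/k` is Hopf Galois. -/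
theorem isHopfGalois_of_isRegularPermGroup {k : Type u} {L : Type v} [Field k] [Field L]
    [Algebra k L] [FiniteDimensional k L] [IsGalois k L] (F : IntermediateField k L)
    (N : Subgroup (Equiv.Perm (Gal(L/k) ⧸ F.fixingSubgroup))) (hN : IsRegularPermGroup N)
    (hnorm : (cosetAction F).range ≤ Subgroup.normalizer (N : Set (Equiv.Perm _))) :
    IsHopfGalois k F := by
  let : MulDistribMulAction Gal(L/k) N :=
    { smul := fun g n => ⟨cosetAction F g * n * (cosetAction F g)⁻¹,
        (Subgroup.mem_normalizer_iff.1 (hnorm ⟨g, rfl⟩) n).1 n.2⟩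
      one_smul := fun n => Subtype.ext (by change cosetAction F 1 * n.1 * _ = _; simp)
      mul_smul := fun g h n => Subtype.ext (by
        change cosetAction F (g * h) * n.1 * (cosetAction F (g * h))⁻¹ =
          cosetAction F g * (cosetAction F h * n.1 * (cosetAction F h)⁻¹) * (cosetAction F g)⁻¹
        simp [mul_assoc])
      smul_mul := fun g n m => Subtype.ext (by
        change cosetAction F g * (n.1 * m.1) * (cosetAction F g)⁻¹ =
          (cosetAction F g * n.1 * (cosetAction F g)⁻¹) *
            (cosetAction F g * m.1 * (cosetAction F g)⁻¹)
        group)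
      smul_one := fun g => Subtype.ext (by
        change cosetAction F g * 1 * (cosetAction F g)⁻¹ = 1
        group) }
  refine isHopfGalois_of_mulAction F (N := N) ?_ ?_
  · intro g n x
    change g • n.1 x = (cosetAction F g * n.1 * (cosetAction F g)⁻¹) (g • x)
    have h : (cosetAction F g)⁻¹ (g • x) = x := by
      rw [← map_inv]
      exact inv_smul_smul g x
    rw [Equiv.Perm.mul_apply, Equiv.Perm.mul_apply, h]
    rfl
  · intro x y
    obtain ⟨σ, ⟨hσ, hxy⟩, huniq⟩ := hN x y
    exact ⟨⟨σ, hσ⟩, hxy, fun τ hτ => Subtype.ext (huniq τ ⟨τ.2, hτ⟩)⟩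

theorem Subgroup.le_normalizer_of_conj_mem {G : Type*} [Group G] {K N : Subgroup G}
    (h : ∀ g ∈ K, ∀ n ∈ N, g * n * g⁻¹ ∈ N) : K ≤ Subgroup.normalizer (N : Set G) := by
  intro g hg
  rw [Subgroup.mem_normalizer_iff]
  refine fun n => ⟨h g hg n, fun hn => ?_⟩
  have := h g⁻¹ (inv_mem hg) _ hn
  simpa [mul_assoc] using this

/-! ### From Hopf Galois structures to regular groups -/

section HopfToRegular

variable {k H : Type u} {L : Type*} [Field k] [Field L] [Algebra k L]
  [Ring H] [HopfAlgebra k H] [Module.Finite k H]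
  (F : IntermediateField k L) (μ : H →ₐ[k] Module.End k F)

/-- The elements of `L ⊗ H`, written in coordinates for a basis of `H`, give linear maps `F → L`
when combined with an embedding of `F`. -/
noncomputable def twistedEmb (x : Gal(L/k) ⧸ F.fixingSubgroup) :
    (Fin (Module.finrank k H) → L) →ₗ[L] (F →ₗ[k] L) where
  toFun c := ∑ i, c i • ((cosetEmb F x).toLinearMap ∘ₗ μ (Module.finBasis k H i))
  map_add' c d := by simp [add_smul, Finset.sum_add_distrib]
  map_smul' r c := by simp [mul_smul, Finset.smul_sum]

theorem twistedEmb_apply (x : Gal(L/k) ⧸ F.fixingSubgroup) (c : Fin (Module.finrank k H) → L)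
    (a : F) :
    twistedEmb F μ x c a = ∑ i, c i * cosetEmb F x (μ (Module.finBasis k H i) a) := by
  simp [twistedEmb]

theorem cosetEmb_action_eq_sum (x : Gal(L/k) ⧸ F.fixingSubgroup) (h : H) (a : F) :
    cosetEmb F x (μ h a) = ∑ i, algebraMap k L ((Module.finBasis k H).repr h i) *
      cosetEmb F x (μ (Module.finBasis k H i) a) := by
  conv_lhs => rw [← (Module.finBasis k H).sum_repr h]
  simp only [map_sum, map_smul, LinearMap.sum_apply, LinearMap.smul_apply]
  simp only [Algebra.smul_def]

theorem twistedEmb_smul (g : Gal(L/k)) (x : Gal(L/k) ⧸ F.fixingSubgroup)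
    (c : Fin (Module.finrank k H) → L) (a : F) :
    twistedEmb F μ (g • x) (fun i => g (c i)) a = g (twistedEmb F μ x c a) := by
  simp [twistedEmb_apply]

theorem exists_twistedEmb_one :
    ∃ c, ∀ x, twistedEmb F μ x c = (cosetEmb F x).toLinearMap := by
  refine ⟨fun i => algebraMap k L ((Module.finBasis k H).repr 1 i), fun x => ?_⟩
  ext a
  rw [twistedEmb_apply, ← cosetEmb_action_eq_sum]
  simp

/-- The coefficients `e` are those of the product `c * d` in `L ⊗ H`, so one `e` serves all pairs
`x`, `y`. -/
theorem exists_twistedEmb_mul (c d : Fin (Module.finrank k H) → L) :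
    ∃ e, ∀ x y, twistedEmb F μ x c = (cosetEmb F y).toLinearMap →
      twistedEmb F μ x e = twistedEmb F μ y d := by
  refine ⟨fun r => ∑ j, ∑ i, d j * (c i * algebraMap k L ((Module.finBasis k H).repr
    (Module.finBasis k H i * Module.finBasis k H j) r)), fun x y h => ?_⟩
  ext a
  have h1 : ∀ b, cosetEmb F y b = ∑ i, c i * cosetEmb F x (μ (Module.finBasis k H i) b) := by
    intro b
    rw [← twistedEmb_apply, h]
    rfl
  rw [twistedEmb_apply, twistedEmb_apply]
  simp only [h1, Finset.mul_sum, Finset.sum_mul]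
  rw [Finset.sum_comm]
  refine Finset.sum_congr rfl fun j _ => ?_
  rw [Finset.sum_comm]
  refine Finset.sum_congr rfl fun i _ => ?_
  rw [← Module.End.mul_apply, ← map_mul μ, cosetEmb_action_eq_sum F μ x _ a, Finset.mul_sum,
    Finset.mul_sum]
  exact Finset.sum_congr rfl fun r _ => by ring

/-- The coefficients of the image of an element of `L ⊗ H` under the comultiplication. -/
theorem exists_twistedEmb_apply_mul (hμ : IsModuleAlgebraAction μ)
    (c : Fin (Module.finrank k H) → L) :
    ∃ E : Fin (Module.finrank k H) → Fin (Module.finrank k H) → L, ∀ x a b,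
      twistedEmb F μ x c (a * b) = ∑ p, ∑ q, E p q *
        (cosetEmb F x (μ (Module.finBasis k H p) a) *
          cosetEmb F x (μ (Module.finBasis k H q) b)) := by
  let β := Module.finBasis k H
  refine ⟨fun p q => ∑ i, c i * algebraMap k L ((β.tensorProduct β).repr
    (Coalgebra.comul (R := k) (β i)) (p, q)), fun x a b => ?_⟩
  have h1 : ∀ h : H, cosetEmb F x (μ h (a * b)) =
      ∑ p, ∑ q, algebraMap k L ((β.tensorProduct β).repr (Coalgebra.comul (R := k) h) (p, q)) *
        (cosetEmb F x (μ (β p) a) * cosetEmb F x (μ (β q) b)) := by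
    intro h
    rw [hμ.2]
    conv_lhs => rw [← (β.tensorProduct β).sum_repr (Coalgebra.comul (R := k) h)]
    rw [Fintype.sum_prod_type]
    simp only [map_sum, map_smul, Module.Basis.tensorProduct_apply, TensorProduct.map_tmul,
      LinearMap.flip_apply, AlgHom.toLinearMap_apply, LinearMap.mul'_apply, map_mul]
    simp only [Algebra.smul_def]
  rw [twistedEmb_apply]
  simp only [h1, Finset.mul_sum, Finset.sum_mul, β]
  rw [Finset.sum_comm]
  refine Finset.sum_congr rfl fun p _ => ?_
  rw [Finset.sum_comm]
  exact Finset.sum_congr rfl fun q _ => Finset.sum_congr rfl fun i _ => by ring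

variable [FiniteDimensional k L] [IsGalois k L]

theorem finrank_eq_of_bijective_hopfGaloisMap (hj : Function.Bijective (hopfGaloisMap μ)) :
    Module.finrank k H = Module.finrank k F := by
  have h := (LinearEquiv.ofBijective _ hj).finrank_eq
  rw [Module.finrank_tensorProduct, Module.finrank_linearMap] at h
  exact Nat.eq_of_mul_eq_mul_left Module.finrank_pos h

/-- Each coordinate functional of a `k`-basis of `F`, viewed as an endomorphism of `F`, is in the
image of `j`. Composed with an embedding, these functionals span `F →ₗ[k] L` over `L`. -/
theorem twistedEmb_surjective (hj : Function.Bijective (hopfGaloisMap μ))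
    (x : Gal(L/k) ⧸ F.fixingSubgroup) : Function.Surjective (twistedEmb F μ x) := by
  intro φ
  have key : ∀ w : F ⊗[k] H, ∃ c, ∀ a, twistedEmb F μ x c a =
      cosetEmb F x (hopfGaloisMap μ w a) := by
    intro w
    induction w with
    | zero => exact ⟨0, by simp⟩
    | add w z hw hz =>
      obtain ⟨c, hc⟩ := hw
      obtain ⟨d, hd⟩ := hz
      exact ⟨c + d, fun a => by simp [hc, hd]⟩
    | tmul s h =>
      refine ⟨fun i => cosetEmb F x s * algebraMap k L ((Module.finBasis k H).repr h i),
        fun a => ?_⟩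
      rw [twistedEmb_apply, hopfGaloisMap_tmul, map_mul, cosetEmb_action_eq_sum F μ x h,
        Finset.mul_sum]
      simp [mul_assoc]
  let e := Module.finBasis k F
  choose w hw using fun j => hj.2 ((Algebra.linearMap k F) ∘ₗ e.coord j)
  choose c hc using fun j => key (w j)
  refine ⟨∑ j, φ (e j) • c j, ?_⟩
  ext a
  simp only [map_sum, map_smul, LinearMap.sum_apply, LinearMap.smul_apply, hc, hw]
  conv_rhs => rw [← e.sum_repr a, map_sum]
  refine Finset.sum_congr rfl fun j _ => ?_
  rw [map_smul, smul_eq_mul, LinearMap.comp_apply, Algebra.linearMap_apply, AlgHom.commutes,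
    Module.Basis.coord_apply, Algebra.smul_def, mul_comm]

theorem twistedEmb_injective (hj : Function.Bijective (hopfGaloisMap μ))
    (x : Gal(L/k) ⧸ F.fixingSubgroup) : Function.Injective (twistedEmb F μ x) := by
  have hdim : Module.finrank L (Fin (Module.finrank k H) → L) =
      Module.finrank L (F →ₗ[k] L) := by
    rw [Module.finrank_linearMap_self, Module.finrank_fin_fun,
      finrank_eq_of_bijective_hopfGaloisMap F μ hj]
  have : Module.Finite L (F →ₗ[k] L) :=
    Module.Finite.of_surjective _ (twistedEmb_surjective F μ hj x)
  exact (LinearMap.injective_iff_surjective_of_finrank_eq_finrank hdim).2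
    (twistedEmb_surjective F μ hj x)

/-- If `c` yields an embedding at one coset, then `c` is group-like in `L ⊗ H`. That condition does
not mention the coset, so `c` yields an embedding at every coset. -/
theorem exists_twistedEmb_eq (hμ : IsModuleAlgebraAction μ)
    (hj : Function.Bijective (hopfGaloisMap μ)) {c : Fin (Module.finrank k H) → L}
    {x y : Gal(L/k) ⧸ F.fixingSubgroup} (h : twistedEmb F μ x c = (cosetEmb F y).toLinearMap)
    (z : Gal(L/k) ⧸ F.fixingSubgroup) :
    ∃ t, twistedEmb F μ z c = (cosetEmb F t).toLinearMap := by
  obtain ⟨E, hE⟩ := exists_twistedEmb_apply_mul F μ hμ c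
  -- Multiplicativity at `x` compares `Δ(c)` with `c ⊗ c`; injectivity is applied once in each
  -- tensor factor.
  have hEc : ∀ p q, E p q = c p * c q := by
    have h1 : ∀ b, twistedEmb F μ x (fun p => ∑ q, (E p q - c p * c q) *
        cosetEmb F x (μ (Module.finBasis k H q) b)) = 0 := by
      intro b
      ext a
      have h2 := hE x a b
      rw [h, AlgHom.toLinearMap_apply, map_mul, ← AlgHom.toLinearMap_apply,
        ← AlgHom.toLinearMap_apply, ← h, twistedEmb_apply, twistedEmb_apply,
        Finset.sum_mul_sum] at h2
      rw [twistedEmb_apply, LinearMap.zero_apply, ← sub_eq_zero.2 h2.symm,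
        ← Finset.sum_sub_distrib]
      refine Finset.sum_congr rfl fun p _ => ?_
      rw [← Finset.sum_sub_distrib, Finset.sum_mul]
      exact Finset.sum_congr rfl fun q _ => by ring
    intro p q
    have h2 : twistedEmb F μ x (fun q => E p q - c p * c q) = 0 := by
      ext b
      rw [twistedEmb_apply]
      have h3 := twistedEmb_injective F μ hj x ((h1 b).trans (map_zero _).symm)
      exact congrFun h3 p
    have h3 := twistedEmb_injective F μ hj x (h2.trans (map_zero _).symm)
    exact sub_eq_zero.1 (congrFun h3 q)
  -- The value at `1` is the counit of `c`, again independent of the coset.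
  have hone : ∀ z, twistedEmb F μ z c 1 =
      ∑ i, c i * algebraMap k L (Coalgebra.counit (R := k) (Module.finBasis k H i)) := by
    intro z
    simp [twistedEmb_apply, hμ.1]
  obtain ⟨t, ht⟩ := cosetEmb_surjective F (AlgHom.ofLinearMap (twistedEmb F μ z c)
    (by rw [hone z, ← hone x, h]; simp)
    (fun a b => by
      rw [hE, twistedEmb_apply, twistedEmb_apply, Finset.sum_mul_sum]
      refine Finset.sum_congr rfl fun p _ => Finset.sum_congr rfl fun q _ => ?_
      rw [hEc]
      ring))
  exact ⟨t, by rw [ht]; rfl⟩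

/-- Take `c` carrying `x` to `y` and `d` carrying `y` to `x`. Their product fixes the embedding at
`x`, so it is the unit of `L ⊗ H` by injectivity; hence `d` undoes `c` at every coset. -/
theorem exists_perm_twistedEmb_eq (hμ : IsModuleAlgebraAction μ)
    (hj : Function.Bijective (hopfGaloisMap μ)) (x y : Gal(L/k) ⧸ F.fixingSubgroup) :
    ∃ σ : Equiv.Perm (Gal(L/k) ⧸ F.fixingSubgroup), σ x = y ∧
      ∃ c, ∀ z, twistedEmb F μ z c = (cosetEmb F (σ z)).toLinearMap := by
  obtain ⟨c, hc⟩ := twistedEmb_surjective F μ hj x (cosetEmb F y).toLinearMap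
  obtain ⟨d, hd⟩ := twistedEmb_surjective F μ hj y (cosetEmb F x).toLinearMap
  choose f hf using exists_twistedEmb_eq F μ hμ hj hc
  choose f' hf' using exists_twistedEmb_eq F μ hμ hj hd
  obtain ⟨e, he⟩ := exists_twistedEmb_mul F μ c d
  obtain ⟨u, hu⟩ := exists_twistedEmb_one F μ
  have hinj : ∀ {z t}, (cosetEmb F z).toLinearMap = (cosetEmb F t).toLinearMap → z = t :=
    fun h => cosetEmb_injective F (AlgHom.toLinearMap_injective h)
  have heu : e = u := by
    apply twistedEmb_injective F μ hj x
    rw [he x y hc, hd, hu]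
  have hleft : Function.LeftInverse f' f := by
    intro z
    apply hinj
    rw [← hf', ← he z (f z) (hf z), heu, hu]
  refine ⟨Equiv.ofBijective f (Finite.injective_iff_bijective.1 hleft.injective), ?_, c, hf⟩
  exact hinj ((hf x).symm.trans hc)

end HopfToRegular

/-- A Hopf Galois structure on `F/k` gives a regular group of permutations of the cosets of
`Gal(L/F)` that is normalized by `Gal(L/k)`. -/
theorem exists_isRegularPermGroup_of_isHopfGalois {k : Type u} {L : Type v} [Field k] [Field L]
    [Algebra k L] [FiniteDimensional k L] [IsGalois k L] (F : IntermediateField k L)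
    (h : IsHopfGalois k F) :
    ∃ N : Subgroup (Equiv.Perm (Gal(L/k) ⧸ F.fixingSubgroup)), IsRegularPermGroup N ∧
      (cosetAction F).range ≤ Subgroup.normalizer (N : Set (Equiv.Perm _)) := by
  obtain ⟨H, _, _, _, -, μ, hμ, hj⟩ := h
  have hinj : ∀ {z t : Gal(L/k) ⧸ F.fixingSubgroup},
      (cosetEmb F z).toLinearMap = (cosetEmb F t).toLinearMap → z = t :=
    fun h => cosetEmb_injective F (AlgHom.toLinearMap_injective h)
  let S : Submonoid (Equiv.Perm (Gal(L/k) ⧸ F.fixingSubgroup)) :=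
    { carrier := {σ | ∃ c, ∀ z, twistedEmb F μ z c = (cosetEmb F (σ z)).toLinearMap}
      one_mem' := exists_twistedEmb_one F μ
      mul_mem' := by
        rintro σ τ ⟨c, hc⟩ ⟨d, hd⟩
        -- The order is reversed: products in `L ⊗ H` compose the permutations in the opposite
        -- order.
        obtain ⟨e, he⟩ := exists_twistedEmb_mul F μ d c
        exact ⟨e, fun z => by rw [he z (τ z) (hd z), hc]; rfl⟩ }
  have huniq : ∀ σ ∈ S, ∀ τ ∈ S, ∀ x, σ x = τ x → σ = τ := by
    rintro σ ⟨c, hc⟩ τ ⟨d, hd⟩ x hx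
    have hcd : c = d := by
      apply twistedEmb_injective F μ hj x
      rw [hc, hd, hx]
    ext z
    apply hinj
    rw [← hc, ← hd, hcd]
  let N : Subgroup (Equiv.Perm (Gal(L/k) ⧸ F.fixingSubgroup)) :=
    { S with
      inv_mem' := by
        intro σ hσ
        let x : Gal(L/k) ⧸ F.fixingSubgroup := (1 : Gal(L/k))
        obtain ⟨τ, hτ, hτS⟩ := exists_perm_twistedEmb_eq F μ hμ hj (σ x) x
        have h1 : τ * σ = 1 := huniq _ (S.mul_mem hτS hσ) _ S.one_mem x hτ
        rw [← eq_inv_of_mul_eq_one_left h1]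
        exact hτS }
  refine ⟨N, fun x y => ?_, Subgroup.le_normalizer_of_conj_mem ?_⟩
  · obtain ⟨σ, hσ, hσS⟩ := exists_perm_twistedEmb_eq F μ hμ hj x y
    exact ⟨σ, ⟨hσS, hσ⟩, fun τ hτ => huniq τ hτ.1 σ hσS x (hτ.2.trans hσ.symm)⟩
  · rintro _ ⟨g, rfl⟩ σ ⟨c, hc⟩
    -- Conjugation by `λ(g)` corresponds to the semilinear action of `g` on `L ⊗ H`.
    refine ⟨fun i => g (c i), fun z => ?_⟩
    ext a
    obtain ⟨x, rfl⟩ : ∃ x, z = g • x := ⟨g⁻¹ • z, by simp⟩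
    have h1 : (cosetAction F g)⁻¹ (g • x) = x := by
      rw [← map_inv]
      exact inv_smul_smul g x
    rw [twistedEmb_smul, hc, Equiv.Perm.mul_apply, Equiv.Perm.mul_apply, h1]
    exact (cosetEmb_smul F g (σ x) a).symm

/-! ### Actions of groups of order 9 on groups of order 12 and 24 -/

section OuterAction

/-- A `3`-group with more than three elements, acting on a group of order `4` or `8`, has a
nontrivial element acting trivially. -/
theorem exists_ne_one_smul_eq_of_card_four_or_eight {S T : Type*} [Group S] [Finite S] [Group T]
    [MulDistribMulAction S T] (hS : IsPGroup 3 S) (hcomm : ∀ a b : S, a * b = b * a)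
    (hcard : 8 < Nat.card S) (hT : Nat.card T = 4 ∨ Nat.card T = 8) :
    ∃ s : S, s ≠ 1 ∧ ∀ t : T, s • t = t := by
  have : Finite T := Nat.finite_of_card_ne_zero (by omega)
  have hcard' : 1 < Nat.card S := by omega
  by_cases hfix : ∀ (s : S) (t : T), s • t = t
  · have : Nontrivial S := Finite.one_lt_card_iff_nontrivial.1 hcard'
    obtain ⟨s, hs⟩ := exists_ne (1 : S)
    exact ⟨s, hs, hfix s⟩
  push Not at hfix
  obtain ⟨s₀, t₀, h₀⟩ := hfix
  -- The orbit of `t₀` has at most 8 points, fewer than `|S|`.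
  have hst : ∃ s ∈ MulAction.stabilizer S t₀, s ≠ 1 := by
    by_contra! h
    have hbot : MulAction.stabilizer S t₀ = ⊥ := (Subgroup.eq_bot_iff_forall _).2 h
    have h1 := MulAction.index_stabilizer S t₀
    rw [hbot, Subgroup.index_bot] at h1
    have h2 := Set.ncard_le_card (MulAction.orbit S t₀)
    omega
  obtain ⟨s, hs, hs1⟩ := hst
  refine ⟨s, hs1, ?_⟩
  -- `C` contains `1`, `t₀` and, as `S` is commutative, `s₀ • t₀`. Its order is at least 3, divides
  -- `|T|` and is congruent to `|T|` modulo 3, which leaves only `|T|`.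
  let C := FixedPoints.subgroup (Subgroup.zpowers s) T
  have hmem : ∀ t : T, t ∈ C ↔ s • t = t := by
    intro t
    constructor
    · intro h
      exact h ⟨s, Subgroup.mem_zpowers s⟩
    · rintro h ⟨r, hr⟩
      have : Subgroup.zpowers s ≤ MulAction.stabilizer S t := by
        rwa [Subgroup.zpowers_le]
      exact this hr
  have h3 : Nat.card T ≡ Nat.card C [MOD 3] :=
    (hS.to_subgroup (Subgroup.zpowers s)).card_modEq_card_fixedPoints T
  have hdvd : Nat.card C ∣ Nat.card T := C.card_subgroup_dvd_card
  have hone : t₀ ≠ 1 := by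
    rintro rfl
    exact h₀ (smul_one s₀)
  have hone' : s₀ • t₀ ≠ 1 := by
    intro h
    exact hone ((smul_eq_iff_eq_inv_smul s₀).1 h |>.trans (smul_one _))
  have hm : t₀ ∈ C := (hmem _).2 hs
  have hm' : s₀ • t₀ ∈ C := by
    rw [hmem, ← mul_smul, hcomm, mul_smul, (hmem _).1 hm]
  have hle : 3 ≤ Nat.card C := by
    have h4 : ({1, t₀, s₀ • t₀} : Set T).ncard = 3 := by
      rw [Set.ncard_eq_three]
      exact ⟨1, t₀, s₀ • t₀, hone.symm, hone'.symm, Ne.symm h₀, rfl⟩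
    rw [← h4]
    refine Set.ncard_le_ncard (t := (C : Set T)) ?_
    rintro t (rfl | rfl | rfl)
    exacts [C.one_mem, hm, hm']
  have heq : Nat.card C = Nat.card T := by
    have hle' := Nat.le_of_dvd (by omega) hdvd
    rcases hT with hT | hT <;> rw [hT] at h3 hdvd hle' ⊢ <;> interval_cases Nat.card C <;>
      simp_all [Nat.ModEq]
  have htop : C = ⊤ := Subgroup.eq_top_of_card_eq C heq
  intro t
  rw [← hmem, htop]
  exact Subgroup.mem_top t

variable {P N : Type*} [Group P] [Group N] {t : ℕ}

theorem Subgroup.eq_top_of_sylow_two_le [Finite N] (hN : Nat.card N = 3 * t)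
    (ht : t = 4 ∨ t = 8) {T K : Subgroup N} (hT : Nat.card T = t) (hTK : T ≤ K) {z : N}
    (hz : orderOf z = 3) (hzK : z ∈ K) : K = ⊤ := by
  apply Subgroup.eq_top_of_card_eq
  have h1 : t ∣ Nat.card K := hT ▸ Subgroup.card_dvd_of_le hTK
  have h2 : 3 ∣ Nat.card K := by
    rw [← hz, ← Nat.card_zpowers]
    exact Subgroup.card_dvd_of_le ((Subgroup.zpowers_le).2 hzK)
  have h3 : 3 * t ∣ Nat.card K := by
    refine Nat.Coprime.mul_dvd_of_dvd_of_dvd ?_ h2 h1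
    rcases ht with rfl | rfl <;> decide
  exact Nat.dvd_antisymm K.card_subgroup_dvd_card (hN ▸ h3)

/-- A group of order nine does not act faithfully by outer automorphisms on a group of order
`12` or `24`. -/
theorem exists_ne_one_eq_conj (hP : Nat.card P = 9) (hN : Nat.card N = 3 * t)
    (ht : t = 4 ∨ t = 8) (φ : P →* MulAut N) : ∃ p, p ≠ 1 ∧ ∃ n, φ p = MulAut.conj n := by
  by_contra! hout
  have hout' : ∀ p n, φ p = MulAut.conj n → p = 1 := fun p n h => by
    by_contra hp
    exact hout p hp n h
  have : Fact (Nat.Prime 3) := ⟨Nat.prime_three⟩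
  have : Fact (Nat.Prime 2) := ⟨Nat.prime_two⟩
  have : Finite P := Nat.finite_of_card_ne_zero (by omega)
  have : Finite N := Nat.finite_of_card_ne_zero (by omega)
  have hPp : IsPGroup 3 P := IsPGroup.of_card (n := 2) hP
  have hPc : ∀ a b : P, a * b = b * a :=
    (IsPGroup.isMulCommutative_of_card_eq_prime_sq (p := 3) hP).is_comm.comm
  -- The number of fixed points of the 3-group `P` is congruent to `|N|`, hence to 0, modulo 3;
  -- Cauchy's theorem applies to the fixed subgroup.
  obtain ⟨z, hz, hfz⟩ : ∃ z : N, orderOf z = 3 ∧ ∀ p, φ p z = z := by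
    let : MulDistribMulAction P N := MulDistribMulAction.compHom N φ
    let C := FixedPoints.subgroup P N
    have h1 : Nat.card N ≡ Nat.card C [MOD 3] := hPp.card_modEq_card_fixedPoints N
    have h2 : 3 ∣ Nat.card C := (h1.dvd_iff dvd_rfl).1 ⟨t, hN⟩
    obtain ⟨z, hz⟩ := exists_prime_orderOf_dvd_card' 3 h2
    exact ⟨z, by rw [← hz, Subgroup.orderOf_coe], fun p => z.2 p⟩
  let T : Sylow 2 N := default
  have hT : Nat.card T = t := by
    have h1 := T.card_eq_multiplicity
    rw [h1, hN]
    rcases ht with rfl | rfl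
    · have : (3 * 4).factorization 2 = 2 := by
        rw [show 3 * 4 = 2 ^ 2 * 3 by norm_num, Nat.factorization_mul (by norm_num) (by norm_num),
          Nat.prime_two.factorization_pow]
        simp [Nat.prime_three.factorization]
      rw [this]; norm_num
    · have : (3 * 8).factorization 2 = 3 := by
        rw [show 3 * 8 = 2 ^ 3 * 3 by norm_num, Nat.factorization_mul (by norm_num) (by norm_num),
          Nat.prime_two.factorization_pow]
        simp [Nat.prime_three.factorization]
      rw [this]; norm_num
  -- `T` and `z` generate `N`.
  have hext : ∀ f : MulAut N, (∀ x ∈ T, f x = x) → f z = z → f = 1 := by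
    intro f hf hfz
    have htop : MonoidHom.eqLocus f.toMonoidHom (MonoidHom.id N) = ⊤ :=
      Subgroup.eq_top_of_sylow_two_le hN ht hT (fun x hx => hf x hx) hz hfz
    ext x
    have : x ∈ MonoidHom.eqLocus f.toMonoidHom (MonoidHom.id N) := htop ▸ Subgroup.mem_top x
    exact this
  by_cases hn : (T : Subgroup N).Normal
  -- If `T` is normal, `P` acts on it, and some `p ≠ 1` fixes both `T` and `z`, so it acts trivially
  -- on `N`.
  · have hchar : (T : Subgroup N).Characteristic := T.characteristic_of_normal hn
    have hmem : ∀ p, ∀ x : T, φ p x ∈ (T : Subgroup N) := by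
      intro p x
      have h1 := Subgroup.characteristic_iff_map_eq.1 hchar (φ p)
      rw [← h1]
      exact ⟨x, x.2, rfl⟩
    let : MulDistribMulAction P T :=
      { smul := fun p x => ⟨φ p x, hmem p x⟩
        one_smul := fun x => Subtype.ext (by change φ 1 x.1 = x.1; simp)
        mul_smul := fun p q x => Subtype.ext (by
          change φ (p * q) x.1 = φ p (φ q x.1); simp)
        smul_mul := fun p x y => Subtype.ext (map_mul (φ p) x.1 y.1)
        smul_one := fun p => Subtype.ext (map_one (φ p)) }
    obtain ⟨p, hp1, hp⟩ := exists_ne_one_smul_eq_of_card_four_or_eight (S := P) (T := T) hPp hPc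
      (by omega) (by rw [hT]; exact ht)
    refine hp1 (hout' p 1 ?_)
    rw [map_one]
    exact hext _ (fun x hx => congrArg Subtype.val (hp ⟨x, hx⟩)) (hfz p)
  -- Otherwise let `P × ⟨z⟩`, of order 27, act on `N`, with `z` acting by conjugation. There are at
  -- most 3 Sylow 2-subgroups, so the stabilizer of `T` has order at least 9, and some `(p, w) ≠ 1`
  -- fixes `T` and `z`. Then `p` acts as conjugation by `w⁻¹`, so `p = 1`; now `w` has order 3 and
  -- centralizes `T`, which makes `T` normal.
  · let Z := Subgroup.zpowers z
    have hfZ : ∀ p, ∀ w ∈ Z, φ p w = w := by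
      rintro p _ ⟨i, rfl⟩
      simp [hfz]
    have hZ : Nat.card Z = 3 := by rw [Nat.card_zpowers, hz]
    have hQ : Nat.card (P × Z) = 27 := by rw [Nat.card_prod, hP, hZ]
    have hQp : IsPGroup 3 (P × Z) := IsPGroup.of_card (n := 3) hQ
    have hQc : ∀ a b : P × Z, a * b = b * a := fun a b => Prod.ext (hPc _ _)
      ((inferInstance : IsMulCommutative (Subgroup.zpowers z)).is_comm.comm _ _)
    let ψ : P × Z →* MulAut N := φ.noncommCoprod (MulAut.conj.comp Z.subtype) (by
      intro p w
      ext x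
      simp [hfZ p w w.2])
    have hψ : ∀ p w x, ψ (p, w) x = φ p (w * x * (w : N)⁻¹) := by
      intro p w x
      rfl
    let : MulDistribMulAction (P × Z) N := MulDistribMulAction.compHom N ψ
    let S := MulAction.stabilizer (P × Z) T
    have hSc : 9 ≤ Nat.card S := by
      have h1 := S.card_mul_index
      have h2 : S.index ≤ 3 := by
        rw [MulAction.index_stabilizer]
        refine (Set.ncard_le_card _).trans ?_
        have h3 : (T : Subgroup N).index = 3 := by
          have h4 := (T : Subgroup N).card_mul_index
          rw [hT, hN, mul_comm] at h4
          exact Nat.eq_of_mul_eq_mul_right (by omega) h4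
        exact Nat.le_of_dvd (by norm_num) (h3 ▸ T.card_dvd_index)
      rw [hQ] at h1
      nlinarith
    have hmem : ∀ s ∈ S, ∀ x : T, ψ s x ∈ (T : Subgroup N) := by
      intro s hs x
      have h1 : s • T = T := hs
      have h2 : (s • T : Sylow 2 N).toSubgroup = (T : Subgroup N) := by rw [h1]
      rw [← h2, Sylow.pointwise_smul_def]
      exact Subgroup.smul_mem_pointwise_smul _ s _ x.2
    let : MulDistribMulAction S T :=
      { smul := fun s x => ⟨ψ s x, hmem s s.2 x⟩
        one_smul := fun x => Subtype.ext (by change ψ 1 x.1 = x.1; simp)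
        mul_smul := fun p q x => Subtype.ext (by
          change ψ (p * q) x.1 = ψ p (ψ q x.1); simp)
        smul_mul := fun p x y => Subtype.ext (map_mul (ψ p) x.1 y.1)
        smul_one := fun p => Subtype.ext (map_one (ψ p)) }
    obtain ⟨⟨⟨p, w⟩, hs⟩, hs1, hsT⟩ := exists_ne_one_smul_eq_of_card_four_or_eight (S := S) (T := T)
      (hQp.to_subgroup S) (fun a b => Subtype.ext (hQc a b)) (by omega) (by rw [hT]; exact ht)
    have hfix : ∀ x ∈ T, φ p (w * x * (w : N)⁻¹) = x := fun x hx =>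
      (hψ p w x).symm.trans (congrArg Subtype.val (hsT ⟨x, hx⟩))
    obtain ⟨i, hi⟩ := w.2
    have hwz : (w : N) * z * (w : N)⁻¹ = z := by
      rw [← hi]
      simp only [mul_inv_cancel_right, (Commute.refl z).zpow_left i |>.eq]
    have h1 : φ p * MulAut.conj (w : N) = 1 :=
      hext _ (fun x hx => by simpa using hfix x hx) (by
        change φ p (w * z * (w : N)⁻¹) = z
        rw [hwz, hfz])
    have hp : p = 1 := hout' p (w : N)⁻¹ (by rw [map_inv]; exact eq_inv_of_mul_eq_one_left h1)
    subst hp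
    have hw1 : w ≠ 1 := by
      rintro rfl
      exact hs1 rfl
    have hwo : orderOf (w : N) = 3 := by
      have h2 : orderOf (w : N) ∣ 3 := by
        rw [Subgroup.orderOf_coe, ← hZ]
        exact orderOf_dvd_natCard w
      rcases (Nat.dvd_prime Nat.prime_three).1 h2 with h | h
      · exact absurd (Subtype.ext (orderOf_eq_one_iff.1 h)) hw1
      · exact h
    apply hn
    have htop : Subgroup.normalizer ((T : Subgroup N) : Set N) = ⊤ :=
      Subgroup.eq_top_of_sylow_two_le hN ht hT Subgroup.le_normalizer hwo (by
        rw [map_one, one_mul] at h1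
        rw [Subgroup.mem_normalizer_iff]
        intro x
        have h3 : (w : N) * x * (w : N)⁻¹ = x := by
          rw [← MulAut.conj_apply, h1, MulAut.one_apply]
        rw [h3])
    exact Subgroup.normalizer_eq_top_iff.1 htop

end OuterAction

/-! ### Regular groups on the cosets of `V` normalized by `G` -/

section RegularOnCosets

variable {G : Type*} [Group G]

theorem IsRegularPermGroup.eq_of_apply_eq {X : Type*} {N : Subgroup (Equiv.Perm X)}
    (hN : IsRegularPermGroup N) {σ τ : Equiv.Perm X} (hσ : σ ∈ N) (hτ : τ ∈ N) {x : X}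
    (h : σ x = τ x) : σ = τ :=
  (hN x (τ x)).unique ⟨hσ, h⟩ ⟨hτ, rfl⟩

theorem IsRegularPermGroup.natCard_eq {X : Type*} [Nonempty X] {N : Subgroup (Equiv.Perm X)}
    (hN : IsRegularPermGroup N) : Nat.card N = Nat.card X := by
  obtain ⟨x⟩ := ‹Nonempty X›
  refine Nat.card_eq_of_bijective (fun σ : N => σ.1 x) ⟨fun σ τ h => ?_, fun y => ?_⟩
  · exact Subtype.ext (hN.eq_of_apply_eq σ.2 τ.2 h)
  · obtain ⟨σ, ⟨hσ, h⟩, -⟩ := hN x y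
    exact ⟨⟨σ, hσ⟩, h⟩

theorem toPermHom_ker_le (V : Subgroup G) : (MulAction.toPermHom G (G ⧸ V)).ker ≤ V := by
  intro g hg
  have h1 : g • ((1 : G) : G ⧸ V) = ((1 : G) : G ⧸ V) :=
    DFunLike.congr_fun (MonoidHom.mem_ker.1 hg) ((1 : G) : G ⧸ V)
  rw [MulAction.Quotient.smul_mk, smul_eq_mul, mul_one, eq_comm, QuotientGroup.eq] at h1
  simpa using h1

/-- Right translation of the cosets of `V` by an element normalizing `V`. -/
def rightTranslation (V : Subgroup G) (d : G) (hd : ∀ v, d⁻¹ * v * d ∈ V ↔ v ∈ V) :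
    Equiv.Perm (G ⧸ V) where
  toFun := Quotient.map' (fun g => g * d) (by
    intro a b h
    rw [QuotientGroup.leftRel_apply] at h ⊢
    have := (hd _).2 h
    simpa [mul_assoc] using this)
  invFun := Quotient.map' (fun g => g * d⁻¹) (by
    intro a b h
    rw [QuotientGroup.leftRel_apply] at h ⊢
    apply (hd _).1
    simpa [mul_assoc] using h)
  left_inv x := by
    induction x using QuotientGroup.induction_on with
    | H g => change ((g * d * d⁻¹ : G) : G ⧸ V) = g; simp
  right_inv x := by
    induction x using QuotientGroup.induction_on with
    | H g => change ((g * d⁻¹ * d : G) : G ⧸ V) = g; simp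

theorem rightTranslation_mk (V : Subgroup G) (d : G) (hd : ∀ v, d⁻¹ * v * d ∈ V ↔ v ∈ V) (g : G) :
    rightTranslation V d hd (g : G ⧸ V) = ((g * d : G) : G ⧸ V) := rfl

/-- If `D` is a complement of the normal subgroup `P` and `V` is normal in `D`, then the left
translations by `P` and the right translations by `D` generate a regular group of permutations of
the cosets of `V`, and it is normalized by all left translations. -/
theorem exists_isRegularPermGroup_of_isComplement' {P D V : Subgroup G} [P.Normal]
    (hPD : P.IsComplement' D) (hVD : V ≤ D) (hnorm : ∀ d ∈ D, ∀ v ∈ V, d⁻¹ * v * d ∈ V) :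
    ∃ N : Subgroup (Equiv.Perm (G ⧸ V)), IsRegularPermGroup N ∧
      (MulAction.toPermHom G (G ⧸ V)).range ≤ Subgroup.normalizer (N : Set (Equiv.Perm _)) ∧
      ∀ σ ∈ N, ∃ p ∈ P, ∃ d ∈ D, ∀ g : G, σ (g : G ⧸ V) = ((p * g * d : G) : G ⧸ V) := by
  have hnorm' : ∀ d ∈ D, ∀ v, d⁻¹ * v * d ∈ V ↔ v ∈ V := by
    refine fun d hd v => ⟨fun h => ?_, hnorm d hd v⟩
    have := hnorm d⁻¹ (inv_mem hd) _ h
    simpa [mul_assoc] using this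
  let N : Subgroup (Equiv.Perm (G ⧸ V)) :=
    { carrier := {σ | ∃ p ∈ P, ∃ d ∈ D, ∀ g : G, σ (g : G ⧸ V) = ((p * g * d : G) : G ⧸ V)}
      one_mem' := ⟨1, one_mem _, 1, one_mem _, fun g => by simp⟩
      mul_mem' := by
        rintro σ τ ⟨p, hp, d, hd, h⟩ ⟨p', hp', d', hd', h'⟩
        refine ⟨p * p', mul_mem hp hp', d' * d, mul_mem hd' hd, fun g => ?_⟩
        rw [Equiv.Perm.mul_apply, h', h]
        simp [mul_assoc]
      inv_mem' := by
        rintro σ ⟨p, hp, d, hd, h⟩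
        refine ⟨p⁻¹, inv_mem hp, d⁻¹, inv_mem hd, fun g => ?_⟩
        rw [Equiv.Perm.inv_eq_iff_eq, h]
        simp [mul_assoc] }
  refine ⟨N, fun x y => ?_, Subgroup.le_normalizer_of_conj_mem ?_, fun σ h => h⟩
  · induction x using QuotientGroup.induction_on with
    | H a =>
    induction y using QuotientGroup.induction_on with
    | H b =>
    -- With `a⁻¹ b = p d`, left translation by `a p a⁻¹` and right translation by `d` together carry
    -- `a` to `b`.
    obtain ⟨⟨⟨p, hp⟩, ⟨d, hd⟩⟩, hpd⟩ := hPD.2 (a⁻¹ * b)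
    change p * d = a⁻¹ * b at hpd
    have hpa : a * p * a⁻¹ ∈ P := Subgroup.Normal.conj_mem inferInstance p hp a
    refine ⟨MulAction.toPermHom G (G ⧸ V) (a * p * a⁻¹) * rightTranslation V d (hnorm' d hd),
      ⟨⟨a * p * a⁻¹, hpa, d, hd, fun g => ?_⟩, ?_⟩, ?_⟩
    · rw [Equiv.Perm.mul_apply, rightTranslation_mk, mul_assoc _ g d]
      rfl
    · rw [Equiv.Perm.mul_apply, rightTranslation_mk]
      change ((a * p * a⁻¹ * (a * d) : G) : G ⧸ V) = b
      rw [show a * p * a⁻¹ * (a * d) = a * (p * d) by group, hpd, mul_inv_cancel_left]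
    · rintro σ ⟨⟨q, hq, e, he, h⟩, hσ⟩
      have h1 : ((q * a * e : G) : G ⧸ V) = b := (h a).symm.trans hσ
      have h2 : (q * a * e)⁻¹ * b ∈ V := QuotientGroup.eq.1 h1
      have hqa : a⁻¹ * q * a ∈ P := by
        have := Subgroup.Normal.conj_mem (inferInstance : P.Normal) q hq a⁻¹
        simpa using this
      -- The discrepancy in `V` between `q a e` and `b` is absorbed into `e`, which stays in `D`;
      -- uniqueness of the factorization `P D` then applies.
      have hed : (a⁻¹ * q * a) * (e * ((q * a * e)⁻¹ * b)) = p * d := by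
        rw [hpd]; group
      have h3 := hPD.1 (a₁ := (⟨⟨_, hqa⟩, ⟨_, mul_mem he (hVD h2)⟩⟩ : P × D))
        (a₂ := (⟨⟨p, hp⟩, ⟨d, hd⟩⟩ : P × D)) hed
      have hq' : a⁻¹ * q * a = p := congrArg (fun w => (w.1 : G)) h3
      have hd' : e * ((q * a * e)⁻¹ * b) = d := congrArg (fun w => (w.2 : G)) h3
      ext x
      induction x using QuotientGroup.induction_on with
      | H g =>
      rw [h, Equiv.Perm.mul_apply, rightTranslation_mk]
      change _ = ((a * p * a⁻¹ * (g * d) : G) : G ⧸ V)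
      rw [← hq', ← hd', QuotientGroup.eq]
      convert h2 using 1
      group
  · rintro _ ⟨c, rfl⟩ σ ⟨p, hp, d, hd, h⟩
    refine ⟨c * p * c⁻¹, Subgroup.Normal.conj_mem inferInstance p hp c, d, hd, fun g => ?_⟩
    rw [Equiv.Perm.mul_apply, Equiv.Perm.mul_apply, ← map_inv]
    have h1 : MulAction.toPermHom G (G ⧸ V) c⁻¹ (g : G ⧸ V) = ((c⁻¹ * g : G) : G ⧸ V) := rfl
    rw [h1, h]
    change ((c * (p * (c⁻¹ * g) * d) : G) : G ⧸ V) = _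
    simp [mul_assoc]

/-- A normal complement `P` of `V` gives a regular group of left translations on the cosets
of `V`. -/
theorem exists_isRegularPermGroup_le_range {P V : Subgroup G} [P.Normal]
    (hPV : P.IsComplement' V) :
    ∃ N : Subgroup (Equiv.Perm (G ⧸ V)), IsRegularPermGroup N ∧
      (MulAction.toPermHom G (G ⧸ V)).range ≤ Subgroup.normalizer (N : Set (Equiv.Perm _)) ∧
      N ≤ (MulAction.toPermHom G (G ⧸ V)).range := by
  -- Taking `D = V` makes all the right translations trivial.
  obtain ⟨N, h1, h2, h3⟩ := exists_isRegularPermGroup_of_isComplement' hPV le_rfl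
    (fun d hd v hv => mul_mem (mul_mem (inv_mem hd) hv) hd)
  refine ⟨N, h1, h2, fun σ hσ => ?_⟩
  obtain ⟨p, -, d, hd, h⟩ := h3 σ hσ
  refine ⟨p, ?_⟩
  ext x
  induction x using QuotientGroup.induction_on with
  | H g =>
  rw [h]
  change ((p * g : G) : G ⧸ V) = _
  rw [QuotientGroup.eq]
  simpa [mul_assoc] using hd

variable {P : Subgroup G}

/-- The kernel lies in `V`; if it were nontrivial it would contain `P`, and 9 would divide `|V|`. -/
theorem toPermHom_injective_of_minimal (hP : Nat.card P = 9)
    (hmin : ∀ M : Subgroup G, M.Normal → M ≠ ⊥ → P ≤ M) {V : Subgroup G}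
    (hV : ¬ 9 ∣ Nat.card V) : Function.Injective (MulAction.toPermHom G (G ⧸ V)) := by
  rw [← MonoidHom.ker_eq_bot_iff]
  by_contra hne
  exact hV (hP ▸ Subgroup.card_dvd_of_le ((hmin _ inferInstance hne).trans (toPermHom_ker_le V)))

/-- A group of order `72` with a normal subgroup of order `9` contained in all nontrivial normal
subgroups does not normalize a regular group of permutations of `12` or `24` cosets. -/
theorem not_isRegularPermGroup_of_index (hG : Nat.card G = 72) (hP : Nat.card P = 9)
    (hmin : ∀ M : Subgroup G, M.Normal → M ≠ ⊥ → P ≤ M) {V : Subgroup G} {t : ℕ}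
    (ht : t = 4 ∨ t = 8) (hV : V.index = 3 * t) {N : Subgroup (Equiv.Perm (G ⧸ V))}
    (hN : IsRegularPermGroup N) (hnorm : (MulAction.toPermHom G (G ⧸ V)).range ≤
      Subgroup.normalizer (N : Set (Equiv.Perm _))) : False := by
  have : Finite G := Nat.finite_of_card_ne_zero (by omega)
  have hV9 : ¬ 9 ∣ Nat.card V := by
    have h1 := V.card_mul_index
    rw [hG, hV] at h1
    rcases ht with rfl | rfl <;> omega
  have hinj := toPermHom_injective_of_minimal hP hmin hV9
  have hNc : Nat.card N = 3 * t := by rw [hN.natCard_eq, ← hV]; rfl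
  have hN9 : ¬ 9 ∣ Nat.card N := by
    rw [hNc]
    rcases ht with rfl | rfl <;> norm_num
  let c : G →* MulAut N := N.normalizerMonoidHom.comp
    ((MulAction.toPermHom G (G ⧸ V)).codRestrict (Subgroup.normalizer (N : Set (Equiv.Perm _)))
      fun g => hnorm ⟨g, rfl⟩)
  have hc : ∀ g (n : N), ((c g n : N) : Equiv.Perm (G ⧸ V)) =
      MulAction.toPermHom G (G ⧸ V) g * n * (MulAction.toPermHom G (G ⧸ V) g)⁻¹ :=
    fun g n => rfl
  have hinner : ((MulAut.conj : N →* MulAut N).range.comap c).Normal := by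
    refine Subgroup.Normal.comap ⟨?_⟩ c
    rintro _ ⟨n, rfl⟩ f
    refine ⟨f n, ?_⟩
    ext m
    simp
  obtain ⟨p, hp1, n, hn⟩ := exists_ne_one_eq_conj hP hNc ht (c.comp P.subtype)
  -- The elements acting by inner automorphisms form a normal subgroup of `G`, now known to be
  -- nontrivial.
  have hPinner : P ≤ (MulAut.conj : N →* MulAut N).range.comap c := by
    refine hmin _ hinner ?_
    intro hbot
    have h1 : (p : G) ∈ (MulAut.conj : N →* MulAut N).range.comap c := ⟨n, hn.symm⟩
    rw [hbot, Subgroup.mem_bot] at h1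
    exact hp1 (Subtype.ext h1)
  by_cases hker : c.ker = ⊥
  · have hcinj := (MonoidHom.ker_eq_bot_iff c).1 hker
    have h1 : Nat.card P ∣ Nat.card (MulAut.conj : N →* MulAut N).range := by
      let f : P →* (MulAut.conj : N →* MulAut N).range :=
        (c.comp P.subtype).codRestrict _ fun p => hPinner p.2
      refine Subgroup.card_dvd_of_injective f fun a b hab => ?_
      exact Subtype.ext (hcinj (congrArg Subtype.val hab))
    have h2 : Nat.card (MulAut.conj : N →* MulAut N).range ∣ Nat.card N :=
      Subgroup.card_range_dvd _
    exact hN9 (hP ▸ h1.trans h2)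
  · have hPker := hmin _ inferInstance hker
    have hcomm : ∀ p ∈ P, ∀ n ∈ N, ∀ x, n (p • x) = p • n x := by
      intro p hp n hn x
      have h1 := congrArg Subtype.val (DFunLike.congr_fun (MonoidHom.mem_ker.1 (hPker hp)) ⟨n, hn⟩)
      rw [hc] at h1
      have h2 : MulAction.toPermHom G (G ⧸ V) p * n = n * MulAction.toPermHom G (G ⧸ V) p :=
        mul_inv_eq_iff_eq_mul.1 h1
      exact (DFunLike.congr_fun h2 x).symm
    let x₀ : G ⧸ V := ((1 : G) : G ⧸ V)
    -- A permutation commuting with the transitive group `N` is determined by its value at `x₀`.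
    -- Sending `p` to the element of `N` that agrees with it there is an injective antihomomorphism;
    -- inverses turn it into a homomorphism.
    choose f hf _ using fun p : P => hN x₀ ((p : G) • x₀)
    have hfmul : ∀ p q, f (p * q) = f q * f p := by
      intro p q
      refine hN.eq_of_apply_eq (hf _).1 (mul_mem (hf q).1 (hf p).1) (x := x₀) ?_
      rw [(hf (p * q)).2, Equiv.Perm.mul_apply, (hf p).2, hcomm p p.2 _ (hf q).1, (hf q).2,
        ← mul_smul]
      rfl
    let F : P →* N := MonoidHom.mk' (fun p => ⟨(f p)⁻¹, inv_mem (hf p).1⟩) (by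
      intro p q
      apply Subtype.ext
      change (f (p * q))⁻¹ = (f p)⁻¹ * (f q)⁻¹
      rw [hfmul, mul_inv_rev])
    have hF : Function.Injective F := by
      intro p q hpq
      have h1 : f p = f q := inv_injective (congrArg Subtype.val hpq)
      apply Subtype.ext
      apply hinj
      ext x
      obtain ⟨n, ⟨hn, hx⟩, -⟩ := hN x₀ x
      have h2 : (p : G) • x₀ = (q : G) • x₀ := by rw [← (hf p).2, ← (hf q).2, h1]
      change (p : G) • x = (q : G) • x
      rw [← hx, ← hcomm p p.2 n hn, ← hcomm q q.2 n hn, h2]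
    exact hN9 (hP ▸ Subgroup.card_dvd_of_injective F hF)

/-- A Sylow 2-subgroup `D` containing `V` has order 8. It is a complement of `P` by coprimality, and
`V` has index 2 in it, hence is normal in it. -/
theorem exists_isRegularPermGroup_of_card_four [P.Normal] (hG : Nat.card G = 72) (hP : Nat.card P = 9)
    {V : Subgroup G} (hV : Nat.card V = 4) :
    ∃ N : Subgroup (Equiv.Perm (G ⧸ V)), IsRegularPermGroup N ∧
      (MulAction.toPermHom G (G ⧸ V)).range ≤ Subgroup.normalizer (N : Set (Equiv.Perm _)) := by
  have : Finite G := Nat.finite_of_card_ne_zero (by omega)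
  have : Fact (Nat.Prime 2) := ⟨Nat.prime_two⟩
  obtain ⟨D, hVD⟩ := (IsPGroup.of_card (p := 2) (n := 2) (G := V) hV).exists_le_sylow
  have hD : Nat.card D = 8 := by
    rw [D.card_eq_multiplicity, hG]
    have : (72 : ℕ).factorization 2 = 3 := by
      rw [show 72 = 2 ^ 3 * 3 ^ 2 by norm_num, Nat.factorization_mul (by norm_num) (by norm_num),
        Nat.prime_two.factorization_pow, Nat.prime_three.factorization_pow]
      simp
    rw [this]; norm_num
  have hPD : P.IsComplement' D :=
    Subgroup.isComplement'_of_coprime (by rw [hP, hD, hG]) (by rw [hP, hD]; decide)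
  have hind : (V.subgroupOf D).index = 2 := by
    have h1 := (V.subgroupOf D).card_mul_index
    rw [Nat.card_congr (Subgroup.subgroupOfEquivOfLe hVD).toEquiv, hV, hD] at h1
    omega
  have hn := Subgroup.normal_of_index_eq_two hind
  obtain ⟨N, h1, h2, -⟩ := exists_isRegularPermGroup_of_isComplement' hPD hVD (by
    intro d hd v hv
    have := hn.conj_mem ⟨v, hVD hv⟩ hv ⟨d, hd⟩⁻¹
    simpa [Subgroup.mem_subgroupOf] using this)
  exact ⟨N, h1, h2⟩

/-- Pulled back to `G`, such an `N` is a normal complement `M` of `V`, of order 18 and containing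
`P`. The image of `M` in `G/P` is normal of order 2, hence central; as `V` is abelian and `G = M V`,
the quotient `G/P` would be abelian. -/
theorem not_isRegularPermGroup_le_range_of_card_four [P.Normal] (hG : Nat.card G = 72)
    (hP : Nat.card P = 9) (hmin : ∀ M : Subgroup G, M.Normal → M ≠ ⊥ → P ≤ M)
    {a b : G} (hab : (a * b)⁻¹ * (b * a) ∉ P) {V : Subgroup G} (hV : Nat.card V = 4)
    {N : Subgroup (Equiv.Perm (G ⧸ V))}
    (hN : IsRegularPermGroup N) (hnorm : (MulAction.toPermHom G (G ⧸ V)).range ≤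
      Subgroup.normalizer (N : Set (Equiv.Perm _)))
    (hle : N ≤ (MulAction.toPermHom G (G ⧸ V)).range) : False := by
  have : Finite G := Nat.finite_of_card_ne_zero (by omega)
  have hinj := toPermHom_injective_of_minimal hP hmin (V := V) (by rw [hV]; norm_num)
  let M := N.comap (MulAction.toPermHom G (G ⧸ V))
  have hMn : M.Normal := by
    refine ⟨fun m hm g => ?_⟩
    have := (Subgroup.mem_normalizer_iff.1 (hnorm ⟨g, rfl⟩) _).1 hm
    change MulAction.toPermHom G (G ⧸ V) (g * m * g⁻¹) ∈ N
    rwa [map_mul, map_mul, map_inv]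
  have hVi : V.index = 18 := by
    have h1 := V.card_mul_index
    rw [hV, hG] at h1
    omega
  have hMc : Nat.card M = 18 := by
    have h1 : M.map (MulAction.toPermHom G (G ⧸ V)) = N := Subgroup.map_comap_eq_self hle
    rw [Nat.card_congr (M.equivMapOfInjective _ hinj).toEquiv, h1, hN.natCard_eq]
    exact hVi
  have hMV : Disjoint M V := by
    rw [Subgroup.disjoint_def]
    intro g hgM hgV
    apply hinj
    refine hN.eq_of_apply_eq hgM (by rw [map_one]; exact one_mem N)
      (x := ((1 : G) : G ⧸ V)) ?_
    rw [map_one]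
    change ((g * 1 : G) : G ⧸ V) = ((1 : G) : G ⧸ V)
    rw [eq_comm, QuotientGroup.eq]
    simpa using hgV
  have hcompl : M.IsComplement' V :=
    Subgroup.isComplement'_of_card_mul_and_disjoint (by rw [hMc, hV, hG]) hMV
  have hPM : P ≤ M := hmin M hMn (by
    intro h
    rw [h] at hMc
    simp at hMc)
  have hcent : ∀ m ∈ M, ∀ x : G ⧸ P, (m : G ⧸ P) * x = x * m := by
    have hcard : Nat.card (M.map (QuotientGroup.mk' P)) = 2 := by
      have h1 := (M.map (QuotientGroup.mk' P)).card_mul_index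
      have h2 : (M.map (QuotientGroup.mk' P)).index = M.index :=
        Subgroup.index_map_eq M (QuotientGroup.mk'_surjective P) (by simpa using hPM)
      have h3 := M.card_mul_index
      have h4 := P.card_mul_index
      have h5 : Nat.card (G ⧸ P) = P.index := rfl
      rw [hMc, hG] at h3
      rw [hP, hG] at h4
      rw [h2, h5] at h1
      have h6 : M.index = 4 := by omega
      rw [h6] at h1
      omega
    have hn : (M.map (QuotientGroup.mk' P)).Normal :=
      hMn.map _ (QuotientGroup.mk'_surjective P)
    intro m hm x
    have hm' : (m : G ⧸ P) ∈ M.map (QuotientGroup.mk' P) := ⟨m, hm, rfl⟩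
    by_cases h1 : (m : G ⧸ P) = 1
    · rw [h1, one_mul, mul_one]
    · obtain ⟨y, -, hy⟩ := (Nat.card_eq_two_iff' (1 : M.map (QuotientGroup.mk' P))).1 hcard
      have h2 := hy ⟨m, hm'⟩ (fun h => h1 (congrArg Subtype.val h))
      have h3 := hy ⟨x * m * x⁻¹, hn.conj_mem _ hm' x⟩ (fun h => h1 (by
        have := congrArg Subtype.val h
        simpa using this))
      have h4 := congrArg Subtype.val (h2.trans h3.symm)
      exact eq_mul_inv_iff_mul_eq.1 h4
  have hVc : ∀ v w : V, v * w = w * v :=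
    have : Fact (Nat.Prime 2) := ⟨Nat.prime_two⟩
    (IsPGroup.isMulCommutative_of_card_eq_prime_sq (p := 2) hV).is_comm.comm
  apply hab
  rw [← QuotientGroup.eq, QuotientGroup.mk_mul, QuotientGroup.mk_mul]
  obtain ⟨⟨⟨m, hm⟩, v⟩, h1⟩ := hcompl.2 a
  obtain ⟨⟨⟨m', hm'⟩, v'⟩, h2⟩ := hcompl.2 b
  change m * v = a at h1
  change m' * v' = b at h2
  have h3 : (v : G) * v' = v' * v := congrArg Subtype.val (hVc v v')
  have h4 : ((v : G) : G ⧸ P) * (v' : G) = (v' : G) * (v : G) := by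
    rw [← QuotientGroup.mk_mul, h3, QuotientGroup.mk_mul]
  rw [← h1, ← h2, QuotientGroup.mk_mul, QuotientGroup.mk_mul]
  calc (m : G ⧸ P) * (v : G) * (m' * (v' : G)) = m * m' * ((v : G) * (v' : G)) := by
        rw [hcent m' hm' (v' : G), mul_assoc, ← mul_assoc _ (_ : G ⧸ P) (m' : G ⧸ P), h4,
          ← hcent m' hm', mul_assoc]
    _ = m' * m * ((v' : G) * (v : G)) := by rw [h4, hcent m hm m']
    _ = m' * (v' : G) * (m * (v : G)) := by
        rw [mul_assoc, ← mul_assoc (m : G ⧸ P), hcent m hm (v' : G)]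
        simp only [mul_assoc]

end RegularOnCosets

/-! ### The structure of `S₃ ≀ S₂` -/

section WreathProduct

theorem prodShear_mem (π : Equiv.Perm (Fin 2)) (τ : Fin 2 → Equiv.Perm (Fin 3)) :
    Equiv.prodShear π τ ∈ F36colon2 := by
  intro x y
  simp [Equiv.prodShear]

theorem exists_eq_prodShear {g : Equiv.Perm (Fin 2 × Fin 3)} (hg : g ∈ F36colon2) :
    ∃ (π : Equiv.Perm (Fin 2)) (τ : Fin 2 → Equiv.Perm (Fin 3)), g = Equiv.prodShear π τ := by
  have h1 : ∀ i x, (g (i, x)).1 = (g (i, 0)).1 := fun i x => (hg (i, x) (i, 0)).2 rfl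
  have hπ : Function.Injective fun i => (g (i, 0)).1 := fun i j h => (hg (i, 0) (j, 0)).1 h
  have hτ : ∀ i, Function.Injective fun x => (g (i, x)).2 := by
    intro i x y h
    have h2 : g (i, x) = g (i, y) := Prod.ext ((h1 i x).trans (h1 i y).symm) h
    exact congrArg Prod.snd (g.injective h2)
  refine ⟨Equiv.ofBijective _ (Finite.injective_iff_bijective.1 hπ),
    fun i => Equiv.ofBijective _ (Finite.injective_iff_bijective.1 (hτ i)), ?_⟩
  ext x : 1
  exact Prod.ext (h1 x.1 x.2) rfl

theorem natCard_F36colon2 : Nat.card F36colon2 = 72 := by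
  have hb : Function.Bijective (fun w : Equiv.Perm (Fin 2) × (Fin 2 → Equiv.Perm (Fin 3)) =>
      (⟨Equiv.prodShear w.1 w.2, prodShear_mem w.1 w.2⟩ : F36colon2)) := by
    constructor
    · rintro ⟨π, τ⟩ ⟨π', τ'⟩ h
      have h1 : ∀ i x, (π i, τ i x) = (π' i, τ' i x) := fun i x =>
        DFunLike.congr_fun (congrArg Subtype.val h) (i, x)
      refine Prod.ext (Equiv.ext fun i => congrArg Prod.fst (h1 i 0)) (funext fun i => ?_)
      exact Equiv.ext fun x => congrArg Prod.snd (h1 i x)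
    · rintro ⟨g, hg⟩
      obtain ⟨π, τ, rfl⟩ := exists_eq_prodShear hg
      exact ⟨(π, τ), rfl⟩
  rw [← Nat.card_eq_of_bijective _ hb]
  simp [Fintype.card_perm, Nat.factorial]

/-- The translations inside the two blocks, as elements of `F₃₆:2`. -/
def blockTranslation : Multiplicative (Fin 2 → Fin 3) →* F36colon2 where
  toFun v := ⟨Equiv.prodShear 1 fun i => Equiv.addRight (v.toAdd i), prodShear_mem _ _⟩
  map_one' := by
    apply Subtype.ext
    ext x : 1
    exact Prod.ext rfl (add_zero x.2)
  map_mul' v w := by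
    apply Subtype.ext
    ext x : 1
    refine Prod.ext rfl ?_
    change x.2 + (v.toAdd x.1 + w.toAdd x.1) = x.2 + w.toAdd x.1 + v.toAdd x.1
    rw [add_assoc, add_comm (v.toAdd x.1)]

theorem blockTranslation_apply (v : Fin 2 → Fin 3) (x : Fin 2 × Fin 3) :
    (blockTranslation (Multiplicative.ofAdd v)).1 x = (x.1, x.2 + v x.1) := rfl

theorem blockTranslation_injective : Function.Injective blockTranslation := by
  intro v w h
  apply Multiplicative.toAdd.injective
  funext i
  have h1 := DFunLike.congr_fun (congrArg Subtype.val h) (i, (0 : Fin 3))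
  have h2 : (0 : Fin 3) + v.toAdd i = 0 + w.toAdd i := congrArg Prod.snd h1
  exact add_left_cancel h2

theorem natCard_range_blockTranslation : Nat.card blockTranslation.range = 9 := by
  rw [← Nat.card_congr (MonoidHom.ofInjective blockTranslation_injective).toEquiv]
  change Nat.card (Fin 2 → Fin 3) = 9
  simp

theorem exists_mul_blockTranslation (g : F36colon2) (v : Fin 2 → Fin 3) :
    ∃ w, g * blockTranslation (Multiplicative.ofAdd v) * g⁻¹ =
      blockTranslation (Multiplicative.ofAdd w) := by
  obtain ⟨π, τ, hg⟩ := exists_eq_prodShear g.2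
  -- Every permutation of `ℤ/3` is affine, so conjugation takes translations to translations.
  have hdec : ∀ (ρ : Equiv.Perm (Fin 3)) (x c : Fin 3), ρ (x + c) = ρ x + (ρ c - ρ 0) := by
    decide
  refine ⟨fun j => τ (π⁻¹ j) (v (π⁻¹ j)) - τ (π⁻¹ j) 0, ?_⟩
  rw [mul_inv_eq_iff_eq_mul]
  apply Subtype.ext
  ext x : 1
  rw [Subgroup.coe_mul, Subgroup.coe_mul, Equiv.Perm.mul_apply, Equiv.Perm.mul_apply,
    blockTranslation_apply, blockTranslation_apply, hg]
  refine Prod.ext rfl ?_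
  change τ x.1 (x.2 + v x.1) =
    τ x.1 x.2 + (τ (π⁻¹ (π x.1)) (v (π⁻¹ (π x.1))) - τ (π⁻¹ (π x.1)) 0)
  rw [show π⁻¹ (π x.1) = x.1 from π.symm_apply_apply x.1, hdec]

instance normal_range_blockTranslation : blockTranslation.range.Normal := by
  refine ⟨?_⟩
  rintro _ ⟨v, rfl⟩ g
  obtain ⟨w, hw⟩ := exists_mul_blockTranslation g v.toAdd
  exact ⟨_, hw.symm⟩

/-- Conjugation can negate a single coordinate `v i ≠ 0`. Dividing `v` by the result leaves a
translation of block `i` alone, by `2 v i = -v i`, which generates all translations of that block;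
swapping the blocks gives the rest. -/
theorem range_blockTranslation_le_of_mem {M : Subgroup F36colon2} (hM : M.Normal)
    {v : Fin 2 → Fin 3} (hv : v ≠ 0) (hvM : blockTranslation (Multiplicative.ofAdd v) ∈ M) :
    blockTranslation.range ≤ M := by
  have hconj : ∀ (v w : Fin 2 → Fin 3) (π : Equiv.Perm (Fin 2)) (τ : Fin 2 → Equiv.Perm (Fin 3)),
      (∀ i x, τ i (x + v i) = τ i x + w (π i)) →
      blockTranslation (Multiplicative.ofAdd v) ∈ M →
      blockTranslation (Multiplicative.ofAdd w) ∈ M := by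
    intro v w π τ h hm
    have h1 := hM.conj_mem _ hm ⟨Equiv.prodShear π τ, prodShear_mem π τ⟩
    convert h1 using 1
    rw [eq_mul_inv_iff_mul_eq]
    apply Subtype.ext
    ext x : 1
    exact Prod.ext rfl (h x.1 x.2).symm
  obtain ⟨i, hi⟩ := Function.ne_iff.1 hv
  have h1 : blockTranslation (Multiplicative.ofAdd (Function.update v i (-v i))) ∈ M := by
    refine hconj v _ 1 (Function.update 1 i (Equiv.neg (Fin 3))) (fun j x => ?_) hvM
    by_cases hj : j = i
    · subst hj
      simp [add_comm]
    · simp [hj]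
  have h2 : ∀ c, blockTranslation (Multiplicative.ofAdd (Pi.single i c)) ∈ M := by
    have h3 : blockTranslation (Multiplicative.ofAdd (Pi.single i (-v i))) ∈ M := by
      have h4 := mul_mem hvM (inv_mem h1)
      rw [← map_inv, ← map_mul, ← ofAdd_neg, ← ofAdd_add] at h4
      convert h4 using 3
      funext j
      by_cases hj : j = i
      · subst hj
        have : ∀ c : Fin 3, -c = c + - -c := by decide
        simpa using this (v j)
      · simp [hj]
    have hdec : ∀ c d : Fin 3, d ≠ 0 → c = 0 ∨ c = -d ∨ c = d := by decide
    intro c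
    rcases hdec c (v i) hi with rfl | rfl | rfl
    · simp
    · exact h3
    · have := inv_mem h3
      rw [← map_inv, ← ofAdd_neg, ← Pi.single_neg, neg_neg] at this
      exact this
  have h3 : ∀ j c, blockTranslation (Multiplicative.ofAdd (Pi.single j c)) ∈ M := by
    intro j c
    refine hconj (Pi.single i c) _ (Equiv.swap i j) 1 (fun l x => ?_) (h2 c)
    by_cases hl : l = i
    · subst hl
      simp
    · have : Equiv.swap i j l ≠ j := fun h => hl (by simpa using (Equiv.swap_apply_eq_iff.1 h))
      simp [hl, this]
  rintro _ ⟨w, rfl⟩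
  have h4 : w = ∏ j, Multiplicative.ofAdd (Pi.single j (w.toAdd j)) := by
    rw [← ofAdd_sum, Finset.univ_sum_single]
    rfl
  change w ∈ M.comap blockTranslation
  rw [h4]
  exact Subgroup.prod_mem _ fun j _ => h3 j _

/-- If `m ∈ M` moves some translation under conjugation, their commutator is a nontrivial
translation in `M`. If not, `m` is itself a translation, since the translations are their own
centralizer. -/
theorem range_blockTranslation_le {M : Subgroup F36colon2} (hM : M.Normal) (hne : M ≠ ⊥) :
    blockTranslation.range ≤ M := by
  obtain ⟨m, hm, hm1⟩ := M.ne_bot_iff_exists_ne_one.1 hne |>.elim fun a ha =>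
    (⟨a.1, a.2, fun h => ha (Subtype.ext h)⟩ : ∃ m : F36colon2, m ∈ M ∧ m ≠ 1)
  by_cases hcomm : ∀ v, m * blockTranslation (Multiplicative.ofAdd v) * m⁻¹ =
      blockTranslation (Multiplicative.ofAdd v)
  · obtain ⟨π, τ, hg⟩ := exists_eq_prodShear m.2
    have h1 : ∀ (v : Fin 2 → Fin 3) i x, τ i (x + v i) = τ i x + v (π i) := by
      intro v i x
      have h2 := congrArg Subtype.val (mul_inv_eq_iff_eq_mul.1 (hcomm v))
      rw [Subgroup.coe_mul, Subgroup.coe_mul, hg] at h2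
      exact congrArg Prod.snd (DFunLike.congr_fun h2 (i, x))
    have hπ : ∀ i, π i = i := by
      intro i
      by_contra h
      have h2 := h1 (Pi.single i 1) i 0
      rw [Pi.single_eq_same, Pi.single_eq_of_ne h, add_zero] at h2
      exact absurd ((τ i).injective h2) (by decide)
    have hτ : ∀ i x, τ i x = x + τ i 0 := by
      intro i x
      have h2 := h1 (fun _ => x) i 0
      rw [zero_add, add_comm] at h2
      exact h2
    have hmv : m = blockTranslation (Multiplicative.ofAdd fun i => τ i 0) := by
      apply Subtype.ext
      rw [hg]
      ext x : 1
      exact Prod.ext (hπ x.1) (hτ x.1 x.2)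
    refine range_blockTranslation_le_of_mem hM ?_ (hmv ▸ hm)
    intro h0
    apply hm1
    rw [hmv, h0]
    exact map_one _
  · push Not at hcomm
    obtain ⟨v, hv⟩ := hcomm
    obtain ⟨w, hw⟩ := exists_mul_blockTranslation m v
    have h1 : m * (blockTranslation (Multiplicative.ofAdd v) * m⁻¹ *
        (blockTranslation (Multiplicative.ofAdd v))⁻¹) ∈ M :=
      mul_mem hm (hM.conj_mem _ (inv_mem hm) _)
    rw [← mul_assoc, ← mul_assoc, hw, ← map_inv, ← map_mul, ← ofAdd_neg, ← ofAdd_add] at h1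
    refine range_blockTranslation_le_of_mem hM ?_ h1
    intro h0
    apply hv
    rw [hw, add_neg_eq_zero.1 h0]

theorem exists_commutator_notMem_range_blockTranslation :
    ∃ a b : F36colon2, (a * b)⁻¹ * (b * a) ∉ blockTranslation.range := by
  refine ⟨⟨Equiv.prodShear 1 (Function.update 1 0 (Equiv.swap 0 1)), prodShear_mem _ _⟩,
    ⟨Equiv.prodShear (Equiv.swap 0 1) 1, prodShear_mem _ _⟩, fun h => ?_⟩
  obtain ⟨v, hv⟩ := h
  rw [eq_inv_mul_iff_mul_eq] at hv
  have h1 : ∀ x : Fin 3, x + v.toAdd 0 = Equiv.swap 0 1 x := fun x =>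
    congrArg Prod.snd (DFunLike.congr_fun (congrArg Subtype.val hv) ((0 : Fin 2), x))
  -- On block 0 the translation would have to act as `swap 0 1`, fixing 2 but moving 0.
  have h2 := h1 2
  have h3 := h1 0
  revert h2 h3
  generalize v.toAdd 0 = c
  revert c
  decide

theorem exists_normal_of_mulEquiv_F36colon2 {G : Type*} [Group G] (e : G ≃* F36colon2) :
    ∃ P : Subgroup G, P.Normal ∧ Nat.card P = 9 ∧
      (∀ M : Subgroup G, M.Normal → M ≠ ⊥ → P ≤ M) ∧ ∃ a b : G, (a * b)⁻¹ * (b * a) ∉ P := by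
  refine ⟨blockTranslation.range.comap e.toMonoidHom, inferInstance, ?_, fun M hM hne => ?_, ?_⟩
  · rw [← natCard_range_blockTranslation]
    exact Nat.card_congr (e.toEquiv.subtypeEquiv fun _ => Iff.rfl)
  · have h1 := range_blockTranslation_le (hM.map e.toMonoidHom e.surjective)
      (by rwa [Ne, Subgroup.map_eq_bot_iff_of_injective _ e.injective])
    intro g hg
    obtain ⟨m, hm, hmg⟩ := h1 hg
    rwa [← e.injective hmg]
  · obtain ⟨a, b, h⟩ := exists_commutator_notMem_range_blockTranslation
    refine ⟨e.symm a, e.symm b, fun h' => h ?_⟩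
    simpa using Subgroup.mem_comap.1 h'

/-- A faithful transitive action of `F₃₆:2` on six points contains a transposition. -/
theorem exists_isSwap_of_mulEquiv_F36colon2 {G X : Type*} [Group G] [MulAction G X]
    [MulAction.IsPretransitive G X] [DecidableEq X] (hX : Nat.card X = 6)
    (hinj : Function.Injective (MulAction.toPermHom G X)) (e : G ≃* F36colon2)
    {P : Subgroup G} (hPn : P.Normal) (hP : Nat.card P = 9) :
    ∃ g : G, (MulAction.toPermHom G X g).IsSwap := by
  have : Finite X := Nat.finite_of_card_ne_zero (by omega)
  have : Finite P := Nat.finite_of_card_ne_zero (by omega)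
  have : Finite G := Finite.of_injective e e.injective
  -- The isomorphism `e` need not respect the points, so the blocks are recovered as `P`-orbits. An
  -- orbit size divides 9 and is at most 6; a single fixed point would, by normality and
  -- transitivity, make `P` act trivially.
  have horb : ∀ x : X, Nat.card (MulAction.orbit P x) = 3 := by
    intro x
    have h1 := MulAction.index_stabilizer P x
    have h2 : (MulAction.orbit P x).ncard ∣ 3 ^ 2 := by
      rw [← h1, show 3 ^ 2 = Nat.card P from hP.symm]
      exact Subgroup.index_dvd_card _
    have h3 := Set.ncard_le_card (MulAction.orbit P x)
    rw [Nat.card_coe_set_eq]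
    obtain ⟨i, hi, h4⟩ := (Nat.dvd_prime_pow Nat.prime_three).1 h2
    interval_cases i
    · exfalso
      have hfix : ∀ p : P, p • x = x := by
        intro p
        obtain ⟨y, hy⟩ := Set.ncard_eq_one.1 h4
        have h5 : p • x ∈ MulAction.orbit P x := MulAction.mem_orbit x p
        have h6 : x ∈ MulAction.orbit P x := MulAction.mem_orbit_self x
        rw [hy, Set.mem_singleton_iff] at h5 h6
        rw [h5, ← h6]
      have hone : ∀ p ∈ P, p = 1 := by
        intro p hp
        apply hinj
        ext y
        obtain ⟨g, rfl⟩ := MulAction.exists_smul_eq G x y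
        have h5 := hPn.conj_mem p hp g⁻¹
        have h6 : (g⁻¹ * p * g⁻¹⁻¹) • x = x := hfix ⟨_, h5⟩
        rw [inv_inv, mul_smul, mul_smul, inv_smul_eq_iff] at h6
        simpa using h6
      have h5 : P = ⊥ := (Subgroup.eq_bot_iff_forall P).2 hone
      rw [h5] at hP
      simp at hP
    · exact h4
    · omega
  let Ω := MulAction.orbitRel.Quotient P X
  have : Fintype Ω := Fintype.ofFinite Ω
  have hΩorb : ∀ ω : Ω, Nat.card ω.orbit = 3 := by
    intro ω
    induction ω using Quotient.inductionOn' with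
    | h x => rw [MulAction.orbitRel.Quotient.orbit_mk]; exact horb x
  have hΩ : Nat.card Ω = 2 := by
    have h1 := Nat.card_congr (MulAction.selfEquivSigmaOrbits' P X)
    rw [Nat.card_sigma, hX] at h1
    simp only [hΩorb, Finset.sum_const, Finset.card_univ, smul_eq_mul,
      ← Nat.card_eq_fintype_card] at h1
    change 6 = Nat.card Ω * 3 at h1
    omega
  let a : Ω ≃ Fin 2 := Finite.equivFinOfCardEq hΩ
  let b : ∀ ω : Ω, ω.orbit ≃ Fin 3 := fun ω => Finite.equivFinOfCardEq (hΩorb ω)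
  let E : X ≃ Fin 2 × Fin 3 := (MulAction.selfEquivSigmaOrbits' P X).trans
    ((Equiv.sigmaCongrRight b).trans ((Equiv.sigmaEquivProd Ω (Fin 3)).trans
      (Equiv.prodCongr a (Equiv.refl (Fin 3)))))
  have hE : ∀ x, (E x).1 = a (Quotient.mk'' x) := fun x => rfl
  have hrel : ∀ x y, (E x).1 = (E y).1 ↔ x ∈ MulAction.orbit P y := by
    intro x y
    rw [hE, hE, a.apply_eq_iff_eq, Quotient.eq'']
    rfl
  have himp : ∀ (g : G) (x y : X), x ∈ MulAction.orbit P y → g • x ∈ MulAction.orbit P (g • y) := by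
    rintro g _ y ⟨p, rfl⟩
    refine ⟨⟨g * p * g⁻¹, hPn.conj_mem p p.2 g⟩, ?_⟩
    change (g * p * g⁻¹) • g • y = g • (p : G) • y
    simp [mul_smul]
  have hiff : ∀ (g : G) (x y : X), g • x ∈ MulAction.orbit P (g • y) ↔ x ∈ MulAction.orbit P y :=
    fun g x y => ⟨fun h => by simpa using himp g⁻¹ _ _ h, himp g x y⟩
  let f : G → F36colon2 := fun g => ⟨E.permCongr (MulAction.toPermHom G X g), fun x y => by
    rw [Equiv.permCongr_apply, Equiv.permCongr_apply, hrel]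
    refine (hiff g _ _).trans ?_
    rw [← hrel, E.apply_symm_apply, E.apply_symm_apply]⟩
  have hf : Function.Injective f := fun g h hgh =>
    hinj (E.permCongr.injective (congrArg Subtype.val hgh))
  -- `G` embeds in the stabilizer of the blocks, which has the same finite order, so it is the whole
  -- stabilizer.
  have hsurj : Function.Surjective f := by
    have h1 : Function.Injective (e.symm ∘ f) := e.symm.injective.comp hf
    have h2 := Finite.injective_iff_surjective.1 h1
    exact fun w => (h2 (e.symm w)).imp fun g hg => e.symm.injective hg
  have hswap : Equiv.swap ((0 : Fin 2), (0 : Fin 3)) (0, 1) ∈ F36colon2 := by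
    change ∀ x y : Fin 2 × Fin 3, _ ↔ _
    decide
  obtain ⟨g, hg⟩ := hsurj ⟨_, hswap⟩
  have h1 : MulAction.toPermHom G X g = E.permCongr.symm (Equiv.swap (0, 0) (0, 1)) := by
    rw [Equiv.eq_symm_apply]
    exact congrArg Subtype.val hg
  refine ⟨g, E.symm (0, 0), E.symm (0, 1), fun h => ?_, ?_⟩
  · exact absurd (E.symm.injective h) (by decide)
  · rw [h1, Equiv.permCongr_symm]
    ext x
    simp [Equiv.permCongr_apply, Equiv.swap_apply_def, Equiv.eq_symm_apply, apply_ite E.symm]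

end WreathProduct

/-! ### Assembling the proof for the intermediate fields -/

section Main

variable {k : Type u} {L : Type v} [Field k] [Field L] [Algebra k L]

/-- `L` is generated by the conjugates of `K`, and an automorphism acting trivially on the cosets
fixes each conjugate pointwise. -/
theorem cosetAction_injective_of_isNormalClosure (K : IntermediateField k L)
    [Algebra.IsAlgebraic k K] [h : IsNormalClosure k K L] :
    Function.Injective (cosetAction K) := by
  have hn : Normal k L := IsNormalClosure.normal (K := K)
  rw [injective_iff_map_eq_one]
  intro g hg
  have htop := (Algebra.IsAlgebraic.isNormalClosure_iff.1 h).2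
  rw [IntermediateField.normalClosure_def''] at htop
  have hle : ⨆ f : Gal(L/k), K.map (f : L →ₐ[k] L) ≤
      IntermediateField.fixedField (Subgroup.zpowers g) := by
    refine iSup_le fun f => ?_
    rw [IntermediateField.le_iff_le, Subgroup.zpowers_le]
    rw [IntermediateField.mem_fixingSubgroup_iff]
    rintro _ ⟨a, ha, rfl⟩
    have h1 : g • (f : Gal(L/k) ⧸ K.fixingSubgroup) = f :=
      DFunLike.congr_fun hg (f : Gal(L/k) ⧸ K.fixingSubgroup)
    rw [MulAction.Quotient.smul_mk, smul_eq_mul, eq_comm, QuotientGroup.eq,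
      IntermediateField.mem_fixingSubgroup_iff] at h1
    have h2 := congrArg f (h1 a ha)
    rw [← AlgEquiv.mul_apply, mul_inv_cancel_left] at h2
    exact h2
  rw [htop, IntermediateField.le_iff_le, IntermediateField.fixingSubgroup_top,
    Subgroup.zpowers_le] at hle
  exact hle

theorem isGalois_of_isNormalClosure (K : IntermediateField k L) [Algebra.IsSeparable k K]
    [h : IsNormalClosure k K L] : IsGalois k L := by
  have hn : Normal k L := IsNormalClosure.normal (K := K)
  have hs : ∀ f : K →ₐ[k] L, Algebra.IsSeparable k f.fieldRange := fun f =>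
    AlgEquiv.Algebra.isSeparable (AlgEquiv.ofInjectiveField f)
  have htop : Algebra.IsSeparable k (IntermediateField.normalClosure k K L) := by
    rw [normalClosure_def]
    infer_instance
  rw [(Algebra.IsAlgebraic.isNormalClosure_iff.1 h).2] at htop
  have := AlgEquiv.Algebra.isSeparable (IntermediateField.topEquiv (F := k) (E := L))
  exact ⟨⟩

theorem finiteDimensional_of_isNormalClosure (K : IntermediateField k L) [FiniteDimensional k K]
    [h : IsNormalClosure k K L] : FiniteDimensional k L := by
  have htop : FiniteDimensional k (IntermediateField.normalClosure k K L) := inferInstance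
  rw [(Algebra.IsAlgebraic.isNormalClosure_iff.1 h).2] at htop
  exact Module.Finite.equiv (IntermediateField.topEquiv (F := k) (E := L)).toLinearEquiv

/-- A transposition is odd, so the kernel of the sign on `G` has order 36 and meets `⟨τ⟩` trivially:
it is a normal complement. -/
theorem finrank_eq_and_isAlmostClassicallyGalois [FiniteDimensional k L] [IsGalois k L]
    (hG : Nat.card Gal(L/k) = 72) {K : IntermediateField k L}
    (hinj : Function.Injective (cosetAction K)) {F : IntermediateField k L} {τ : Gal(L/k)}
    (hτ : IsTranspositionOn K τ) (hF : F.fixingSubgroup = Subgroup.zpowers τ) :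
    Module.finrank k F = 36 ∧ IsAlmostClassicallyGalois F := by
  classical
  have := Fintype.ofFinite (Gal(L/k) ⧸ K.fixingSubgroup)
  have hsw : (cosetAction K τ).IsSwap := by
    unfold IsTranspositionOn at hτ
    convert hτ
  have hord : orderOf τ = 2 := by
    rw [← orderOf_injective _ hinj, hsw.orderOf]
  have hV : Nat.card F.fixingSubgroup = 2 := by rw [hF, Nat.card_zpowers, hord]
  let s : Gal(L/k) →* ℤˣ := Equiv.Perm.sign.comp (cosetAction K)
  have hsτ : s τ = -1 := hsw.sign_eq
  have hs : Function.Surjective s := by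
    intro e
    rcases Int.units_eq_one_or e with rfl | rfl
    · exact ⟨1, map_one s⟩
    · exact ⟨τ, hsτ⟩
  have hM : Nat.card s.ker = 36 := by
    have h1 := s.ker.card_mul_index
    rw [Subgroup.index_ker, MonoidHom.range_eq_top.2 hs, Subgroup.card_top, hG] at h1
    have h2 : Nat.card ℤˣ = 2 := by simp
    rw [h2] at h1
    omega
  have hdisj : Disjoint s.ker F.fixingSubgroup := by
    rw [Subgroup.disjoint_def, hF]
    rintro _ hg ⟨i, rfl⟩
    have h1 : s (τ ^ i) = 1 := hg
    rw [map_zpow, hsτ] at h1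
    change τ ^ i = 1
    rcases Int.even_or_odd i with hi | hi
    · exact orderOf_dvd_iff_zpow_eq_one.1 (by rw [hord]; exact_mod_cast hi.two_dvd)
    · rw [hi.neg_one_zpow] at h1
      exact absurd h1 (by decide)
  have hcompl : s.ker.IsComplement' F.fixingSubgroup :=
    Subgroup.isComplement'_of_card_mul_and_disjoint (by rw [hM, hV, hG]) hdisj
  refine ⟨?_, exists_isRegularPermGroup_le_range hcompl⟩
  rw [IntermediateField.finrank_eq_fixingSubgroup_index, hcompl.index_eq_card, hM]

/-- A transposition of six points fixes a point; conjugating that point to the trivial coset puts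
the transposition into `Gal(L/K)`. -/
theorem exists_mem_fixingSubgroup_isTranspositionOn [FiniteDimensional k L]
    {K : IntermediateField k L} (hK : K.fixingSubgroup.index = 6)
    (hinj : Function.Injective (cosetAction K)) (e : Gal(L/k) ≃* F36colon2) :
    ∃ τ ∈ K.fixingSubgroup, IsTranspositionOn K τ := by
  classical
  obtain ⟨P, hPn, hP, -⟩ := exists_normal_of_mulEquiv_F36colon2 e
  obtain ⟨g, x, y, hxy, hg⟩ := exists_isSwap_of_mulEquiv_F36colon2
    (X := Gal(L/k) ⧸ K.fixingSubgroup) hK hinj e hPn hP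
  obtain ⟨z, hz⟩ : ∃ z : Gal(L/k) ⧸ K.fixingSubgroup, z ∉ ({x, y} : Set _) := by
    by_contra! h
    have h1 : ({x, y} : Set (Gal(L/k) ⧸ K.fixingSubgroup)) = Set.univ :=
      Set.eq_univ_of_forall h
    have h2 := Set.ncard_pair hxy
    rw [h1, Set.ncard_univ] at h2
    have h3 : Nat.card (Gal(L/k) ⧸ K.fixingSubgroup) = 6 := hK
    omega
  simp only [Set.mem_insert_iff, Set.mem_singleton_iff, not_or] at hz
  induction z using QuotientGroup.induction_on with
  | H h =>
  have hgh : g • (h : Gal(L/k) ⧸ K.fixingSubgroup) = h := by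
    have h1 : g • (h : Gal(L/k) ⧸ K.fixingSubgroup) = Equiv.swap x y h :=
      DFunLike.congr_fun hg (h : Gal(L/k) ⧸ K.fixingSubgroup)
    rw [h1, Equiv.swap_apply_of_ne_of_ne hz.1 hz.2]
  refine ⟨h⁻¹ * g * h, ?_, ?_⟩
  · rw [MulAction.Quotient.smul_mk, smul_eq_mul, eq_comm, QuotientGroup.eq] at hgh
    rwa [mul_assoc]
  · unfold IsTranspositionOn
    refine ⟨h⁻¹ • x, h⁻¹ • y, fun h1 => hxy (smul_left_cancel _ h1), ?_⟩
    have h1 : cosetAction K g = Equiv.swap x y := hg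
    rw [map_mul, map_mul, h1, map_inv]
    have h2 := Equiv.mul_swap_eq_swap_mul ((cosetAction K h)⁻¹) x y
    rw [h2, inv_mul_cancel_right, ← map_inv]
    congr

end Main

theorem mainTheorem10 {k : Type u} {L : Type v} [Field k] [Field L] [Algebra k L]
    (K : IntermediateField k L) [Algebra.IsSeparable k K] [IsNormalClosure k K L]
    (hK : Module.finrank k K = 6) (hG : Nonempty (Gal(L/k) ≃* F36colon2)) :
    (∀ F : IntermediateField k L, K ≤ F → Module.finrank k F = 12 → ¬ IsHopfGalois k F) ∧
    (∀ F : IntermediateField k L, K ≤ F → Module.finrank k F = 18 →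
      IsHopfGalois k F ∧ ¬ IsAlmostClassicallyGalois F) ∧
    (∀ F : IntermediateField k L, K ≤ F → Module.finrank k F = 24 → ¬ IsHopfGalois k F) ∧
    (∃ F : IntermediateField k L, K ≤ F ∧ Module.finrank k F = 36 ∧
      (∃ τ : Gal(L/k), IsTranspositionOn K τ ∧ F.fixingSubgroup = Subgroup.zpowers τ) ∧
      IsAlmostClassicallyGalois F) ∧
    (∀ F : IntermediateField k L, K ≤ F →
      (∃ τ : Gal(L/k), IsTranspositionOn K τ ∧ F.fixingSubgroup = Subgroup.zpowers τ) →
      Module.finrank k F = 36 ∧ IsAlmostClassicallyGalois F) := by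
  obtain ⟨e⟩ := hG
  have : FiniteDimensional k K := Module.finite_of_finrank_pos (by omega)
  have : FiniteDimensional k L := finiteDimensional_of_isNormalClosure K
  have : IsGalois k L := isGalois_of_isNormalClosure K
  have hinj := cosetAction_injective_of_isNormalClosure K
  have hcard : Nat.card Gal(L/k) = 72 :=
    (Nat.card_congr e.toEquiv).trans natCard_F36colon2
  obtain ⟨P, hPn, hP, hmin, a, b, hab⟩ := exists_normal_of_mulEquiv_F36colon2 e
  -- The degrees 12 and 24 are `3 * t` with `t` the order of a Sylow 2-subgroup of `N`.
  have hnot : ∀ (t : ℕ) (_ : t = 4 ∨ t = 8) (F : IntermediateField k L),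
      Module.finrank k F = 3 * t → ¬ IsHopfGalois k F := by
    intro t ht F hF hHG
    obtain ⟨N, hN, hnorm⟩ := exists_isRegularPermGroup_of_isHopfGalois F hHG
    rw [IntermediateField.finrank_eq_fixingSubgroup_index] at hF
    exact not_isRegularPermGroup_of_index hcard hP hmin ht hF hN hnorm
  have htrans : ∀ F : IntermediateField k L,
      (∃ τ : Gal(L/k), IsTranspositionOn K τ ∧ F.fixingSubgroup = Subgroup.zpowers τ) →
      Module.finrank k F = 36 ∧ IsAlmostClassicallyGalois F := fun F ⟨τ, hτ, hF⟩ =>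
    finrank_eq_and_isAlmostClassicallyGalois hcard hinj hτ hF
  refine ⟨fun F _ => hnot 4 (Or.inl rfl) F, fun F _ hF => ?_, fun F _ => hnot 8 (Or.inr rfl) F, ?_,
    fun F _ => htrans F⟩
  · have hV : Nat.card F.fixingSubgroup = 4 := by
      have h1 := F.fixingSubgroup.card_mul_index
      rw [← IntermediateField.finrank_eq_fixingSubgroup_index, hF, hcard] at h1
      omega
    constructor
    · obtain ⟨N, hN, hnorm⟩ := exists_isRegularPermGroup_of_card_four hcard hP hV
      exact isHopfGalois_of_isRegularPermGroup F N hN hnorm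
    · rintro ⟨N, hN, hnorm, hle⟩
      exact not_isRegularPermGroup_le_range_of_card_four hcard hP hmin hab hV hN hnorm hle
  · rw [IntermediateField.finrank_eq_fixingSubgroup_index] at hK
    obtain ⟨τ, hτK, hτ⟩ := exists_mem_fixingSubgroup_isTranspositionOn hK hinj e
    have hfix : (IntermediateField.fixedField (Subgroup.zpowers τ)).fixingSubgroup =
        Subgroup.zpowers τ := IntermediateField.fixingSubgroup_fixedField _
    obtain ⟨h1, h2⟩ := htrans _ ⟨τ, hτ, hfix⟩
    refine ⟨_, ?_, h1, ⟨τ, hτ, hfix⟩, h2⟩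
    rw [IntermediateField.le_iff_le, Subgroup.zpowers_le]
    exact hτK
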